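/- Let $n\ge d\ge 1$ be integers and let $\mathbb{F}$ be an arbitrary field. Let $\Gamma_{n-d+1}$ be the simplicial complex consisting of the isolated vertices $1,2,\ldots,n-d+1$, let $\Delta_{d-2}$ be the $(d-2)$-simplex with vertex set $\{n-d+2,\ldots,n\}$ (for $d=1$ this is the complex $\{\emptyset\}$), and let $\Delta=\Delta_{d-2}\ast\Gamma_{n-d+1}$ be their join, i.e. $\Delta=\{F\cup G : F\in\Delta_{d-2},\ G\in\Gamma_{n-d+1}\}$. Then $\Delta$ is a $(d-1)$-dimensional simplicial complex which is balanced (its vertex set can be partitioned into $d$ color classes such that every face contains at most one vertex of each class) and Cohen–Macaulay over $\mathbb{F}$ (every homogeneous system of parameters of the Stanley–Reisner ring $\mathbb{F}[\Delta]=S/I_\Delta$, $S=\mathbb{F}[x_1,\ldots,x_n]$, is a regular sequence). Moreover, the graded Betti numbers $\beta_{i,i+1}(\mathbb{F}[\Delta])=\dim_{\mathbb{F}}\mathrm{Tor}^S_i(\mathbb{F}[\Delta],\mathbb{F})_{i+1}$ satisfy $$\beta_{i,i+1}(\mathbb{F}[\Delta])=i\binom{n-d+1}{i+1}\qquad\text{for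 all } i\ge 0.$$ -/

import Mathlib

/-! ### Finite abstract simplicial complexes (the empty set is a face, of dimension `-1`) -/

/-- An abstract simplicial complex with vertices in `V`: a collection of finite subsets of `V`,
containing `∅`, that is closed under inclusion. Its vertex set consists of the `v` such that
`{v}` is a face; it may be smaller than `V`. -/
@[ext]
structure FaceComplex (V : Type*) where
  faces : Set (Finset V)
  empty_mem : ∅ ∈ faces
  down_closed : ∀ ⦃G F : Finset V⦄, F ∈ faces → G ⊆ F → G ∈ faces

namespace FaceComplex

/-- The vertex set of a complex. -/
def vertices {V : Type*} (Δ : FaceComplex V) : Set V := {v | {v} ∈ Δ.faces}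

/-- `Δ` has dimension `k`: the maximum of `|F| - 1` over the faces `F` exists and is `k`. -/
def HasDimension {V : Type*} (Δ : FaceComplex V) (k : ℤ) : Prop :=
  IsGreatest ((fun F : Finset V => (F.card : ℤ) - 1) '' Δ.faces) k

/-- A `(d - 1)`-dimensional complex is balanced if its vertex set has a partition into `d` color
classes such that every face contains at most one vertex of each class. -/
def IsBalanced {V : Type*} (Δ : FaceComplex V) : Prop :=
  ∃ d : ℕ, Δ.HasDimension ((d : ℤ) - 1) ∧
    ∃ P : Fin d → Set V, Pairwise (fun k l => Disjoint (P k) (P l)) ∧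
      (⋃ k, P k) = Δ.vertices ∧
      ∀ F ∈ Δ.faces, ∀ k, ((F : Set V) ∩ P k).ncard ≤ 1

/-- The simplex with vertex set `W`: all subsets of `W` are faces. -/
def simplex {V : Type*} (W : Finset V) : FaceComplex V where
  faces := {F | F ⊆ W}
  empty_mem := Finset.empty_subset W
  down_closed := fun _ _ hF hG => hG.trans hF

/-- The complex consisting of the isolated vertices in `W`. -/
def isolatedVertices {V : Type*} (W : Finset V) : FaceComplex V where
  faces := {F | F ⊆ W ∧ F.card ≤ 1}
  empty_mem := ⟨Finset.empty_subset W, by simp⟩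
  down_closed := fun _ _ hF hG => ⟨hG.trans hF.1, (Finset.card_le_card hG).trans hF.2⟩

/-- The join of two complexes (to be used for complexes with disjoint vertex sets). -/
def join {V : Type*} [DecidableEq V] (Δ Γ : FaceComplex V) : FaceComplex V where
  faces := {H | ∃ F ∈ Δ.faces, ∃ G ∈ Γ.faces, H = F ∪ G}
  empty_mem := ⟨∅, Δ.empty_mem, ∅, Γ.empty_mem, by simp⟩
  down_closed := by
    rintro H _ ⟨F, hF, G, hG, rfl⟩ hH
    refine ⟨H ∩ F, Δ.down_closed hF Finset.inter_subset_right,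
      H ∩ G, Γ.down_closed hG Finset.inter_subset_right, ?_⟩
    rw [← Finset.inter_union_distrib_left, Finset.inter_eq_left.mpr hH]

/-- The Stanley-Reisner ideal `I_Δ = (x_F : F ∉ Δ)` in the polynomial ring over `𝔽` with one
variable for each element of `V`. -/
noncomputable def stanleyReisnerIdeal (𝔽 : Type*) [Field 𝔽] {V : Type*} (Δ : FaceComplex V) :
    Ideal (MvPolynomial V 𝔽) :=
  Ideal.span ((fun F : Finset V => ∏ v ∈ F, MvPolynomial.X v) '' Δ.facesᶜ)

end FaceComplex

/-! ### Cohen-Macaulay quotients of polynomial rings -/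

/-- `θ = (θ₁, …, θ_d)` is a homogeneous system of parameters for `S/I`, where `S = 𝔽[x_v]`:
the `θ_k` are homogeneous of positive degree, `d` is the Krull dimension of `S/I`, and
`dim S/(I, θ₁, …, θ_k) = dim S/I - k` for `k ≤ d`. If all degrees are `1`, this is a linear
system of parameters. -/
def IsHomogeneousSOP {𝔽 V : Type*} [Field 𝔽] (I : Ideal (MvPolynomial V 𝔽))
    (θ : List (MvPolynomial V 𝔽)) : Prop :=
  (∀ f ∈ θ, ∃ k : ℕ, 0 < k ∧ f.IsHomogeneous k) ∧
  ringKrullDim (MvPolynomial V 𝔽 ⧸ I) = (θ.length : WithBot ℕ∞) ∧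
  ∀ k ≤ θ.length, ringKrullDim (MvPolynomial V 𝔽 ⧸ (I ⊔ Ideal.ofList (θ.take k))) + (k : WithBot ℕ∞) =
    ringKrullDim (MvPolynomial V 𝔽 ⧸ I)

/-- `S/I` (for a homogeneous ideal `I`) is Cohen-Macaulay: every homogeneous system of parameters
is a regular sequence for `S/I`. Systems of parameters of arbitrary positive degrees are used since
linear ones need not exist over a finite field; over an infinite field it is equivalent to demand
this of the linear ones only. -/
def IsCohenMacaulayQuotient {𝔽 V : Type*} [Field 𝔽] (I : Ideal (MvPolynomial V 𝔽)) : Prop :=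
  ∀ θ : List (MvPolynomial V 𝔽), IsHomogeneousSOP I θ →
    RingTheory.Sequence.IsRegular (MvPolynomial V 𝔽 ⧸ I) θ

/-- `Δ` is Cohen-Macaulay over `𝔽`: its Stanley-Reisner ring is Cohen-Macaulay. -/
def FaceComplex.IsCohenMacaulay (𝔽 : Type*) [Field 𝔽] {V : Type*} (Δ : FaceComplex V) : Prop :=
  IsCohenMacaulayQuotient (Δ.stanleyReisnerIdeal 𝔽)

/-! ### Graded Betti numbers

`Tor_i^S(R, 𝔽)_j` is computed by resolving `𝔽` over `S = 𝔽[x_0, …, x_{n-1}]` by the Koszul complex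
`K_i = ⨁_{|W| = i} S e_W`, with `e_W` in degree `|W|` and
`e_W ↦ ∑_{v ∈ W} (-1)^{#{w ∈ W | w < v}} x_v e_{W ∖ v}`, and tensoring with `R`. An element of
`K ⊗_S M` is written as the family of its coefficients in `M`. -/

/-- The Koszul differential on `⨁_W M e_W`. -/
noncomputable def koszulD (𝔽 : Type*) [Field 𝔽] (n : ℕ) (M : Type*) [AddCommGroup M]
    [Module (MvPolynomial (Fin n) 𝔽) M] :
    (Finset (Fin n) → M) →ₗ[MvPolynomial (Fin n) 𝔽] (Finset (Fin n) → M) where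
  toFun f W := ∑ v ∈ Wᶜ,
    ((-1) ^ (W.filter (· < v)).card * MvPolynomial.X v : MvPolynomial (Fin n) 𝔽) • f (insert v W)
  map_add' f g := by
    funext W
    simp [smul_add, Finset.sum_add_distrib]
  map_smul' c f := by
    funext W
    simp only [Pi.smul_apply, RingHom.id_apply, Finset.smul_sum]
    exact Finset.sum_congr rfl fun v _ => smul_comm _ _ _

theorem koszulD_apply {𝔽 : Type*} [Field 𝔽] {n : ℕ} {M : Type*} [AddCommGroup M]
    [Module (MvPolynomial (Fin n) 𝔽) M] (f : Finset (Fin n) → M) (W : Finset (Fin n)) :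
    koszulD 𝔽 n M f W = ∑ v ∈ Wᶜ,
      ((-1) ^ (W.filter (· < v)).card * MvPolynomial.X v : MvPolynomial (Fin n) 𝔽) •
        f (insert v W) := rfl

theorem koszul_sign_insert {R : Type*} [CommRing R] {n : ℕ} (W : Finset (Fin n)) (u v : Fin n)
    (hv : v ∉ W) :
    ((-1 : R)) ^ ((insert v W).filter (· < u)).card =
      (if v < u then -1 else 1) * (-1) ^ (W.filter (· < u)).card := by
  rw [Finset.filter_insert]
  split_ifs with h
  · rw [Finset.card_insert_of_notMem (by simp [hv]), pow_succ]; ring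
  · simp

theorem koszul_sign_swap {R : Type*} [CommRing R] {n : ℕ} (W : Finset (Fin n)) (u v : Fin n)
    (hu : u ∉ W) (hv : v ∉ W) (huv : u ≠ v) :
    ((-1 : R)) ^ ((insert v W).filter (· < u)).card * (-1) ^ ((W).filter (· < v)).card =
      - ((-1) ^ ((insert u W).filter (· < v)).card * (-1) ^ (W.filter (· < u)).card) := by
  rw [koszul_sign_insert W u v hv, koszul_sign_insert W v u hu]
  rcases lt_or_gt_of_ne huv with h | h
  · simp [h, h.not_gt]; ring
  · simp [h, h.not_gt]; ring

/-- The Koszul complex is a complex. -/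
theorem koszulD_koszulD {𝔽 : Type*} [Field 𝔽] {n : ℕ} {M : Type*} [AddCommGroup M]
    [Module (MvPolynomial (Fin n) 𝔽) M] (f : Finset (Fin n) → M) :
    koszulD 𝔽 n M (koszulD 𝔽 n M f) = 0 := by
  funext W
  simp only [koszulD_apply, Finset.smul_sum, Pi.zero_apply]
  rw [Finset.sum_sigma']
  refine Finset.sum_involution (fun p _ => ⟨p.2, p.1⟩) ?_ ?_ ?_ ?_
  · rintro ⟨u, v⟩ h
    simp only [Finset.mem_sigma, Finset.mem_compl, Finset.mem_insert, not_or] at h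
    obtain ⟨hu, hvu, hv⟩ := h
    simp only [smul_smul, Finset.insert_comm v u]
    rw [← add_smul]
    refine (congrArg (· • f (insert u (insert v W))) ?_).trans
      (zero_smul (MvPolynomial (Fin n) 𝔽) _)
    have := koszul_sign_swap (R := MvPolynomial (Fin n) 𝔽) W u v hu hv (Ne.symm hvu)
    linear_combination (MvPolynomial.X u * MvPolynomial.X v : MvPolynomial (Fin n) 𝔽) * this
  · rintro ⟨u, v⟩ h - heq
    simp only [Finset.mem_sigma, Finset.mem_compl, Finset.mem_insert, not_or] at h
    simp only [Sigma.mk.injEq] at heq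
    exact h.2.1 heq.1
  · rintro ⟨u, v⟩ h
    simp only [Finset.mem_sigma, Finset.mem_compl, Finset.mem_insert, not_or] at h ⊢
    exact ⟨h.2.2, Ne.symm h.2.1, h.1⟩
  · intros; rfl

theorem koszulD_coeff {𝔽 : Type*} [Field 𝔽] {n : ℕ}
    (f : Finset (Fin n) → MvPolynomial (Fin n) 𝔽) (W : Finset (Fin n)) (a : Fin n →₀ ℕ) :
    MvPolynomial.coeff a (koszulD 𝔽 n _ f W) = ∑ v ∈ Wᶜ, (-1) ^ (W.filter (· < v)).card *
      (if v ∈ a.support then MvPolynomial.coeff (a - Finsupp.single v 1) (f (insert v W))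
        else 0) := by
  rw [koszulD_apply, MvPolynomial.coeff_sum]
  refine Finset.sum_congr rfl fun v _ => ?_
  have h : ((-1) ^ (W.filter (· < v)).card : MvPolynomial (Fin n) 𝔽) =
      MvPolynomial.C ((-1) ^ (W.filter (· < v)).card) := by simp
  rw [smul_eq_mul, h, mul_assoc, MvPolynomial.coeff_C_mul, MvPolynomial.coeff_X_mul']

/-- The Koszul complex over the polynomial ring is exact in positive homological degrees, so
it is a graded free resolution of `𝔽 = S/(x_0, …, x_{n-1})`. -/
theorem koszulD_exact {𝔽 : Type*} [Field 𝔽] {n : ℕ}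
    (f : Finset (Fin n) → MvPolynomial (Fin n) 𝔽) (hf : koszulD 𝔽 n _ f = 0) (h0 : f ∅ = 0) :
    ∃ g, koszulD 𝔽 n _ g = f := by
  classical
  have key : ∀ (p : MvPolynomial (Fin n) 𝔽) (e : Fin n →₀ ℕ) (c : (Fin n →₀ ℕ) → Prop),
      ∃ q : MvPolynomial (Fin n) 𝔽, ∀ a, MvPolynomial.coeff a q =
        if c a then MvPolynomial.coeff (a + e) p else 0 := by
    intro p e c
    refine ⟨∑ a ∈ (p.divMonomial e).support.filter c,
      MvPolynomial.monomial a (MvPolynomial.coeff a (p.divMonomial e)), fun a => ?_⟩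
    rw [MvPolynomial.coeff_sum]
    simp only [MvPolynomial.coeff_monomial, Finset.sum_ite_eq', Finset.mem_filter,
      MvPolynomial.mem_support_iff, MvPolynomial.coeff_divMonomial, add_comm e a]
    by_cases h : c a <;> by_cases h' : MvPolynomial.coeff (a + e) p = 0 <;> simp [h, h']
  choose q hq using key
  let c : Fin n → Finset (Fin n) → (Fin n →₀ ℕ) → Prop := fun v U a => ∀ w < v, w ∉ U ∧ a w = 0
  let g : Finset (Fin n) → MvPolynomial (Fin n) 𝔽 := fun U =>
    ∑ v ∈ U, MvPolynomial.C ((-1) ^ ((U.erase v).filter (· < v)).card) *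
      q (f (U.erase v)) (Finsupp.single v 1) (c v U)
  have hg : ∀ U a, MvPolynomial.coeff a (g U) = ∑ v ∈ U,
      (-1) ^ ((U.erase v).filter (· < v)).card * (if c v U a then
        MvPolynomial.coeff (a + Finsupp.single v 1) (f (U.erase v)) else 0) := by
    intro U a
    simp only [g, MvPolynomial.coeff_sum, MvPolynomial.coeff_C_mul, hq]
    refine Finset.sum_congr rfl fun v _ => ?_
    congr
  refine ⟨g, funext fun W => MvPolynomial.ext _ _ fun a => ?_⟩
  rw [koszulD_coeff]
  by_cases hb : (Finset.univ.filter fun w : Fin n => w ∈ W ∨ a w ≠ 0).Nonempty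
  swap
  · simp only [Finset.not_nonempty_iff_eq_empty, Finset.filter_eq_empty_iff, Finset.mem_univ,
      true_implies, not_or, not_not] at hb
    have hW : W = ∅ := Finset.eq_empty_of_forall_notMem fun w => (hb (x := w)).1
    rw [hW, h0, MvPolynomial.coeff_zero]
    refine Finset.sum_eq_zero fun v _ => ?_
    simp [(hb (x := v)).2]
  obtain ⟨v, hvm, hmin⟩ : ∃ v, (v ∈ W ∨ a v ≠ 0) ∧ ∀ w < v, w ∉ W ∧ a w = 0 := by
    refine ⟨Finset.min' _ hb, by simpa using Finset.min'_mem _ hb, fun w hw => ?_⟩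
    by_contra hcon
    have : w ∈ Finset.univ.filter fun w : Fin n => w ∈ W ∨ a w ≠ 0 := by
      simp only [Finset.mem_filter, Finset.mem_univ, true_and]; tauto
    exact absurd (Finset.min'_le _ _ this) (not_le.mpr hw)
  have hcoef : ∀ u, u ∉ W → a u ≠ 0 →
      MvPolynomial.coeff (a - Finsupp.single u 1) (g (insert u W)) =
      if v ∈ insert u W then (-1) ^ (((insert u W).erase v).filter (· < v)).card *
        MvPolynomial.coeff (a - Finsupp.single u 1 + Finsupp.single v 1)
          (f ((insert u W).erase v)) else 0 := by
    intro u hu hau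
    have huv : v ≤ u := by
      by_contra h
      exact hau (hmin u (not_le.mp h)).2
    have hc : ∀ w ∈ insert u W, (c w (insert u W) (a - Finsupp.single u 1) ↔ w = v) := by
      intro w hw
      constructor
      · intro h
        rcases lt_trichotomy w v with h1 | h1 | h1
        · rcases Finset.mem_insert.mp hw with rfl | h2
          · exact absurd huv (not_le.mpr h1)
          · exact absurd h2 (hmin w h1).1
        · exact h1
        · have := h v h1
          simp only [Finset.mem_insert, not_or, Finsupp.coe_tsub, Pi.sub_apply] at this
          rw [Finsupp.single_apply, if_neg (Ne.symm this.1.1)] at this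
          rcases hvm with h2 | h2
          · exact absurd h2 this.1.2
          · exact absurd (by simpa using this.2) h2
      · rintro rfl x hx
        refine ⟨?_, by simp [(hmin x hx).2]⟩
        rw [Finset.mem_insert, not_or]
        exact ⟨fun h => absurd huv (not_le.mpr (h ▸ hx)), (hmin x hx).1⟩
    rw [hg]
    split_ifs with h
    · rw [Finset.sum_eq_single v]
      · rw [if_pos ((hc v h).2 rfl)]
      · intro w hw hwv
        rw [if_neg fun h => hwv ((hc w hw).1 h), mul_zero]
      · exact fun h' => absurd h h'
    · refine Finset.sum_eq_zero fun w hw => ?_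
      rw [if_neg, mul_zero]
      intro h'
      exact h ((hc w hw).1 h' ▸ hw)
  by_cases hvW : v ∈ W
  · obtain ⟨W', hv', rfl⟩ : ∃ W', v ∉ W' ∧ W = insert v W' :=
      ⟨W.erase v, Finset.notMem_erase v W, (Finset.insert_erase hvW).symm⟩
    have hd := koszulD_coeff f W' (a + Finsupp.single v 1)
    rw [hf, Pi.zero_apply, MvPolynomial.coeff_zero,
      ← Finset.add_sum_erase _ _ (Finset.mem_compl.mpr hv'), if_pos (by simp),
      add_tsub_cancel_right] at hd
    have hset : W'ᶜ.erase v = (insert v W')ᶜ := by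
      ext x; simp
    rw [hset] at hd
    have hs : ((-1 : 𝔽) ^ (W'.filter (· < v)).card) * (-1) ^ (W'.filter (· < v)).card = 1 := by
      rw [← mul_pow]; simp
    have : MvPolynomial.coeff a (f (insert v W')) =
        - ∑ x ∈ (insert v W')ᶜ, (-1) ^ (W'.filter (· < v)).card *
          ((-1) ^ (W'.filter (· < x)).card *
          if x ∈ (a + Finsupp.single v 1).support then
            MvPolynomial.coeff (a + Finsupp.single v 1 - Finsupp.single x 1) (f (insert x W'))
          else 0) := by
      rw [← Finset.mul_sum]
      linear_combination (-(-1) ^ (W'.filter (· < v)).card) * hd -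
        MvPolynomial.coeff a (f (insert v W')) * hs
    rw [this, ← Finset.sum_neg_distrib]
    refine Finset.sum_congr rfl fun u hu => ?_
    simp only [Finset.mem_compl, Finset.mem_insert, not_or] at hu
    have hiff : u ∈ (a + Finsupp.single v 1).support ↔ u ∈ a.support := by
      simp [Ne.symm hu.1]
    simp only [hiff]
    split_ifs with hau
    · have hau' : a u ≠ 0 := by simpa using hau
      rw [hcoef u (by simp [hu]) hau', if_pos (by simp)]
      have he : (insert u (insert v W')).erase v = insert u W' := by
        rw [Finset.insert_comm, Finset.erase_insert]
        simp [hv', Ne.symm hu.1]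
      have ha : a - Finsupp.single u 1 + Finsupp.single v 1 =
          a + Finsupp.single v 1 - Finsupp.single u 1 := by
        ext x
        simp only [Finsupp.coe_add, Finsupp.coe_tsub, Pi.add_apply, Pi.sub_apply,
          Finsupp.single_apply]
        by_cases h1 : u = x
        · subst h1; simp [Ne.symm hu.1]
        · simp [h1]
      rw [he, ha]
      have hsw := koszul_sign_swap (R := 𝔽) W' u v hu.2 hv' hu.1
      have hs' : ((-1 : 𝔽) ^ ((insert u W').filter (· < v)).card) *
          (-1) ^ ((insert u W').filter (· < v)).card = 1 := by
        rw [← mul_pow]; simp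
      have hfin : (-1 : 𝔽) ^ ((insert v W').filter (· < u)).card *
          (-1) ^ ((insert u W').filter (· < v)).card =
          - ((-1) ^ (W'.filter (· < v)).card * (-1) ^ (W'.filter (· < u)).card) := by
        linear_combination ((-1 : 𝔽) ^ ((insert u W').filter (· < v)).card *
          (-1) ^ (W'.filter (· < v)).card) * hsw -
          ((-1 : 𝔽) ^ ((insert v W').filter (· < u)).card *
          (-1) ^ ((insert u W').filter (· < v)).card) * hs -
          ((-1) ^ (W'.filter (· < v)).card * (-1) ^ (W'.filter (· < u)).card) * hs'
      linear_combination MvPolynomial.coeff (a + Finsupp.single v 1 - Finsupp.single u 1)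
        (f (insert u W')) * hfin
    · simp
  · have hav : a v ≠ 0 := hvm.resolve_left hvW
    rw [Finset.sum_eq_single v]
    · rw [if_pos (by simpa using hav), hcoef v hvW hav, if_pos (by simp),
        Finset.erase_insert hvW, ← mul_assoc, ← mul_pow]
      have : a - Finsupp.single v 1 + Finsupp.single v 1 = a := by
        refine tsub_add_cancel_of_le ?_
        rw [Finsupp.single_le_iff]; omega
      simp [this]
    · intro u hu huv
      split_ifs with h
      · rw [hcoef u (by simpa using hu) (by simpa using h), if_neg, mul_zero]
        simp [hvW, Ne.symm huv]
      · simp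
    · intro h; simp [hvW] at h

/-- The cokernel of the Koszul complex over the polynomial ring is `S/(x_0, …, x_{n-1})`. -/
theorem koszulD_zero_mem {𝔽 : Type*} [Field 𝔽] {n : ℕ} (p : MvPolynomial (Fin n) 𝔽) :
    (∃ g, koszulD 𝔽 n _ g ∅ = p) ↔ p ∈ Ideal.span (Set.range MvPolynomial.X) := by
  constructor
  · rintro ⟨g, rfl⟩
    rw [koszulD_apply]
    refine Ideal.sum_mem _ fun v _ => ?_
    simpa using Ideal.mul_mem_right (g {v}) _
      (Ideal.subset_span (Set.mem_range_self v) :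
        (MvPolynomial.X v : MvPolynomial (Fin n) 𝔽) ∈ Ideal.span (Set.range MvPolynomial.X))
  · intro hp
    obtain ⟨c, rfl⟩ := (Ideal.mem_span_range_iff_exists_fun).1 hp
    refine ⟨fun U => ∑ v ∈ U, c v, ?_⟩
    rw [koszulD_apply]
    simp [mul_comm]

/-- The component of degree `k` of `S/I`. -/
noncomputable def quotientDegree {𝔽 V : Type*} [Field 𝔽] (I : Ideal (MvPolynomial V 𝔽)) (k : ℕ) :
    Submodule 𝔽 (MvPolynomial V 𝔽 ⧸ I) :=
  (MvPolynomial.homogeneousSubmodule V 𝔽 k).map (Ideal.Quotient.mkₐ 𝔽 I).toLinearMap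

/-- The part of homological degree `i` and internal degree `j` of `K ⊗_S S/I`: families supported
on the sets of cardinality `i`, with coefficients in `(S/I)_{j-i}`. -/
noncomputable def koszulPart {𝔽 : Type*} [Field 𝔽] {n : ℕ} (I : Ideal (MvPolynomial (Fin n) 𝔽))
    (i j : ℕ) : Submodule 𝔽 (Finset (Fin n) → MvPolynomial (Fin n) 𝔽 ⧸ I) :=
  Submodule.pi Set.univ fun W => if W.card = i ∧ i ≤ j then quotientDegree I (j - i) else ⊥

/-- The cycles of homological degree `i` and internal degree `j`. -/
noncomputable def koszulCycles {𝔽 : Type*} [Field 𝔽] {n : ℕ} (I : Ideal (MvPolynomial (Fin n) 𝔽))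
    (i j : ℕ) : Submodule 𝔽 (Finset (Fin n) → MvPolynomial (Fin n) 𝔽 ⧸ I) :=
  koszulPart I i j ⊓
    LinearMap.ker ((koszulD 𝔽 n (MvPolynomial (Fin n) 𝔽 ⧸ I)).restrictScalars 𝔽)

/-- The boundaries of homological degree `i` and internal degree `j`. -/
noncomputable def koszulBoundaries {𝔽 : Type*} [Field 𝔽] {n : ℕ}
    (I : Ideal (MvPolynomial (Fin n) 𝔽)) (i j : ℕ) :
    Submodule 𝔽 (Finset (Fin n) → MvPolynomial (Fin n) 𝔽 ⧸ I) :=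
  (koszulPart I (i + 1) j).map
    ((koszulD 𝔽 n (MvPolynomial (Fin n) 𝔽 ⧸ I)).restrictScalars 𝔽)

/-- The graded Betti number `β_{i,j}(S/I) = dim_𝔽 Tor_i^S(S/I, 𝔽)_j` for a homogeneous ideal `I`
of `S = 𝔽[x_0, …, x_{n-1}]`. -/
noncomputable def gradedBetti {𝔽 : Type*} [Field 𝔽] {n : ℕ} (I : Ideal (MvPolynomial (Fin n) 𝔽))
    (i j : ℕ) : ℕ :=
  Module.finrank 𝔽
    (koszulCycles I i j ⧸ (koszulBoundaries I i j).submoduleOf (koszulCycles I i j))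

universe u
/-! ### Depth and regular sequences -/

/-! Let `W` be the set of isolated vertices, of size n-d+1. The faces of the join are exactly the
sets with at most one vertex in `W`, so the nonfaces are the sets containing two vertices of `W`.
The algebraic part uses only this description.

Cohen–Macaulayness. The d-1 variables outside `W`, followed by the sum of the variables of `W`, form
a regular sequence of length d; this is checked monomial by monomial. The dimension is at most d,
since modulo a prime at most one variable of `W` survives. It remains to pass from one long regular
sequence to every homogeneous system of parameters θ (`isCohenMacaulayQuotient_of_isWeaklyRegular`).
If the first k terms of θ are regular, the quotient by them still has depth at least d-k (Rees' Ext
criterion). A zero divisor θ_{k+1} would lie in an associated prime p inside the irrelevant ideal.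
Depth is at most dim S/p, and dim S/p is at most dim S/(I, θ_1, …, θ_{k+1}), which is k+1 less than
dim S/I: a contradiction.

Betti numbers. A chain in the linear strand has coefficients c(T,v) of x_v e_{T∖v}, with |T| = i+1,
taken with the Koszul sign, besides terms x_v e_G with v in G, which vanish on cycles. Boundaries
are the cycles for which c(T,v) does not depend on v. A cycle satisfies c(T,u) = c(T,v) whenever
{u,v} is a face. If T has a vertex outside `W`, that vertex is joined to all others and c(T,·) is
constant; if T lies in `W`, no condition arises. So each (i+1)-subset of `W` contributes the
functions on T modulo constants, a space of dimension i. -/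

open scoped Pointwise in
theorem smul_top_quotSMulTop_ne_top {R M : Type*} [CommRing R] [AddCommGroup M] [Module R M]
    {I : Ideal R} {x : R} (hx : x ∈ I) (hI : I • (⊤ : Submodule R M) ≠ ⊤) :
    I • (⊤ : Submodule R (QuotSMulTop x M)) ≠ ⊤ := by
  intro h
  have h' := congrArg (Submodule.comap (Submodule.mkQ _)) h
  exact hI (by simpa [Submodule.comap_smul_top_of_surjective I _ (Submodule.mkQ_surjective _),
    Submodule.smul_mono_left ((Ideal.span_singleton_le_iff_mem I).mpr hx),
    ← Submodule.ideal_span_singleton_smul] using h')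

open RingTheory.Sequence CategoryTheory CategoryTheory.Abelian CategoryTheory.Limits in
/-- Passing to the quotient by a regular element lowers the depth by at most one. -/
theorem exists_isRegular_quotSMulTop {R : Type u} [CommRing R] [IsNoetherianRing R] (I : Ideal R)
    {M : Type u} [AddCommGroup M] [Module R M] [Module.Finite R M]
    (hI : I • (⊤ : Submodule R M) ≠ ⊤) {x : R} (hxI : x ∈ I) (hx : IsSMulRegular M x)
    {rs : List R} (hrs : IsRegular M rs) (hmem : ∀ r ∈ rs, r ∈ I) {k : ℕ}
    (hk : rs.length = k + 1) :
    ∃ rs' : List R, rs'.length = k ∧ (∀ r ∈ rs', r ∈ I) ∧ IsRegular (QuotSMulTop x M) rs' := by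
  -- Rees: regular sequences of length k+1 in `I` exist iff certain Ext^i into `M` vanish for i <
  -- k+1. The long exact sequence of 0 → M → M → M/xM → 0 places Ext^i(-, M/xM) between Ext^i(-, M)
  -- and Ext^{i+1}(-, M), so one degree of vanishing is lost.
  have t1 := (ModuleCat.exists_isRegular_tfae I (k + 1) (ModuleCat.of R M) hI.lt_top).out 3 1
  have h1 := t1.mp ⟨rs, hk, hmem, hrs⟩
  have t2 := (ModuleCat.exists_isRegular_tfae I k (ModuleCat.of R (QuotSMulTop x M))
    (smul_top_quotSMulTop_ne_top hxI hI).lt_top).out 1 3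
  refine t2.mp fun i hi => ?_
  have zero1 := AddCommGrpCat.isZero_of_iff_subsingleton.mpr (h1 i (by omega))
  have zero2 := AddCommGrpCat.isZero_of_iff_subsingleton.mpr (h1 (i + 1) (by omega))
  have hx' : IsSMulRegular (ModuleCat.of R M) x := hx
  exact AddCommGrpCat.subsingleton_of_isZero <| ShortComplex.Exact.isZero_of_both_zeros
    ((Ext.covariant_sequence_exact₃' _ hx'.smulShortComplex_shortExact) i (i + 1) rfl)
    (zero1.eq_zero_of_src _) (zero2.eq_zero_of_tgt _)

open RingTheory.Sequence in
theorem exists_isRegular_quot_ofList {R : Type u} [CommRing R] [IsNoetherianRing R] (I : Ideal R)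
    (θ : List R) {M : Type u} [AddCommGroup M] [Module R M] [Module.Finite R M]
    (hI : I • (⊤ : Submodule R M) ≠ ⊤) (hθI : ∀ x ∈ θ, x ∈ I) (hθ : IsWeaklyRegular M θ)
    {rs : List R} (hrs : IsRegular M rs) (hmem : ∀ r ∈ rs, r ∈ I) {k : ℕ}
    (hk : rs.length = k + θ.length) :
    ∃ rs' : List R, rs'.length = k ∧ (∀ r ∈ rs', r ∈ I) ∧
      IsRegular (M ⧸ (Ideal.ofList θ • ⊤ : Submodule R M)) rs' := by
  induction θ generalizing M rs with
  | nil =>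
    refine ⟨rs, by simpa using hk, hmem, ?_⟩
    exact ((Submodule.quotEquivOfEqBot _ (by simp)).isRegular_congr rs).mpr hrs
  | cons x θ ih =>
    rw [isWeaklyRegular_cons_iff] at hθ
    obtain ⟨rs₁, h1, h2, h3⟩ := exists_isRegular_quotSMulTop I hI (hθI x (by simp)) hθ.1 hrs hmem
      (k := k + θ.length) (by simpa [add_assoc] using hk)
    obtain ⟨rs', h1', h2', h3'⟩ := ih (smul_top_quotSMulTop_ne_top (hθI x (by simp)) hI)
      (fun y hy => hθI y (by simp [hy])) hθ.2 h3 h2 h1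
    exact ⟨rs', h1', h2', ((Submodule.quotOfListConsSMulTopEquivQuotSMulTopInner M x
      θ).isRegular_congr rs').mpr h3'⟩

/-- An element whose annihilator lies in a prime `q` has an associated prime between the two. -/
theorem exists_isAssociatedPrime_le {R M : Type*} [CommRing R] [IsNoetherianRing R]
    [AddCommGroup M] [Module R M] {q : Ideal R} [q.IsPrime] (u : M)
    (hu : ∀ s : R, s • u = 0 → s ∈ q) :
    ∃ p : Ideal R, IsAssociatedPrime p M ∧ (∀ s : R, s • u = 0 → s ∈ p) ∧ p ≤ q := by
  -- Over a Noetherian ring, a minimal prime over the annihilator of an element is itself the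
  -- annihilator of an element.
  obtain ⟨p, hp, hpq⟩ := Ideal.exists_minimalPrimes_le
    (I := (⊥ : Submodule R M).colon {u}) (J := q) (fun s hs => hu s (by simpa using hs))
  refine ⟨p, isAssociatedPrime_iff.mpr ⟨hp.1.1, Submodule.exists_eq_colon_of_mem_minimalPrimes hp⟩,
    fun s hs => hp.1.2 (by simpa using hs), hpq⟩

open scoped Pointwise in
/-- Associated primes of `M` specialise to associated primes of `M / xM`. -/
theorem IsAssociatedPrime.exists_quotSMulTop {R M : Type*} [CommRing R] [IsNoetherianRing R]
    [AddCommGroup M] [Module R M] [Module.Finite R M] {m p : Ideal R} [m.IsMaximal]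
    (hp : IsAssociatedPrime p M) (hpm : p ≤ m) {x : R} (hxm : x ∈ m) (hx : IsSMulRegular M x) :
    ∃ q : Ideal R, IsAssociatedPrime q (QuotSMulTop x M) ∧ p ≤ q ∧ x ∈ q ∧ q ≤ m := by
  obtain ⟨-, u, hu⟩ := isAssociatedPrime_iff.mp hp
  -- The elements of `M` killed by `p`.
  let N : Submodule R M :=
    { carrier := {v | ∀ s ∈ p, s • v = 0}
      add_mem' := fun ha hb s hs => by rw [smul_add, ha s hs, hb s hs, add_zero]
      zero_mem' := fun s _ => smul_zero s
      smul_mem' := fun c v hv s hs => by rw [smul_comm, hv s hs, smul_zero] }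
  have huN : u ∈ N := fun s hs => by
    rw [hu] at hs; simpa using hs
  -- Otherwise every element of `N` lies in xM locally at `m`. If sv = xw, then w is again killed by
  -- `p` because x is regular, so N ≤ mN. Nakayama gives r ≡ 1 mod `m` killing `u`, although Ann u =
  -- p ≤ m.
  obtain ⟨v, hvN, hv⟩ : ∃ v ∈ N, ∀ s : R, s • v ∈ x • (⊤ : Submodule R M) → s ∈ m := by
    by_contra! hcon
    have hN : N ≤ m • N := by
      intro v hv
      obtain ⟨s, hs, hsm⟩ := hcon v hv
      obtain ⟨w, -, hw⟩ := (Submodule.mem_smul_pointwise_iff_exists _ _ _).mp hs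
      have hwN : w ∈ N := fun t ht => hx (by
        change x • t • w = x • (0 : M)
        rw [smul_comm, hw, smul_comm, hv t ht, smul_zero, smul_zero])
      obtain ⟨t, a, ha, hta⟩ := Ideal.IsMaximal.exists_inv ‹m.IsMaximal› hsm
      have : v = x • t • w + a • v := by
        rw [smul_comm, hw, smul_smul, ← add_smul, hta, one_smul]
      rw [this]
      exact add_mem (Submodule.smul_mem_smul hxm (N.smul_mem _ hwN))
        (Submodule.smul_mem_smul ha hv)
    obtain ⟨r, hr, hrN⟩ := Submodule.exists_sub_one_mem_and_smul_eq_zero_of_fg_of_le_smul m N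
      (IsNoetherian.noetherian N) hN
    have hrp : r ∈ p := by rw [hu]; simpa using hrN u huN
    exact (Ideal.ne_top_iff_one m).mp (Ideal.IsPrime.ne_top inferInstance)
      (by simpa using m.sub_mem (hpm hrp) hr)
  obtain ⟨q, hq, hvq, hqm⟩ := exists_isAssociatedPrime_le (q := m)
    (Submodule.Quotient.mk v : QuotSMulTop x M) fun s hs => hv s (by
      rwa [← Submodule.Quotient.mk_smul, Submodule.Quotient.mk_eq_zero] at hs)
  refine ⟨q, hq, fun s hs => hvq s ?_, hvq x ?_, hqm⟩
  · rw [← Submodule.Quotient.mk_smul, hvN s hs, Submodule.Quotient.mk_zero]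
  · rw [← Submodule.Quotient.mk_smul, Submodule.Quotient.mk_eq_zero]
    exact Submodule.smul_mem_pointwise_smul _ _ _ trivial

open RingTheory.Sequence in
/-- The depth of `M` is at most `dim R / p` for every associated prime `p`. -/
theorem IsAssociatedPrime.length_le_ringKrullDim {R : Type*} [CommRing R] [IsNoetherianRing R]
    {m : Ideal R} [m.IsMaximal] (rs : List R) {M : Type*} [AddCommGroup M] [Module R M]
    [Module.Finite R M] (hrs : IsWeaklyRegular M rs) (hmem : ∀ r ∈ rs, r ∈ m) {p : Ideal R}
    (hp : IsAssociatedPrime p M) (hpm : p ≤ m) :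
    (rs.length : WithBot ℕ∞) ≤ ringKrullDim (R ⧸ p) := by
  induction rs generalizing M p with
  | nil =>
    have := hp.isPrime
    simpa using ringKrullDim_nonneg_of_nontrivial
  | cons x rs ih =>
    rw [isWeaklyRegular_cons_iff] at hrs
    obtain ⟨q, hq, hpq, hxq, hqm⟩ := hp.exists_quotSMulTop hpm (hmem x (by simp)) hrs.1
    have h1 := ih hrs.2 (fun r hr => hmem r (by simp [hr])) hq hqm
    -- `p` kills a nonzero element and x is regular, so x lies in `q` but not in `p`: the dimension
    -- drops by at least one from R/p to R/q.
    have hxp : x ∉ p := by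
      obtain ⟨-, u, hu⟩ := isAssociatedPrime_iff.mp hp
      intro hxp
      have h2 : x • u = 0 := by rw [hu] at hxp; simpa using hxp
      have h3 : u = 0 := hrs.1 (by simpa using h2)
      exact hp.isPrime.ne_top (by rw [hu, h3]; simp)
    have := hp.isPrime
    have h2 : ringKrullDim (R ⧸ q) + 1 ≤ ringKrullDim (R ⧸ p) :=
      ringKrullDim_succ_le_of_surjective (Ideal.Quotient.factor hpq)
        (Ideal.Quotient.factor_surjective hpq) (r := Ideal.Quotient.mk p x)
        (mem_nonZeroDivisors_of_ne_zero (by rwa [Ne, Ideal.Quotient.eq_zero_iff_mem]))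
        (by simpa [Ideal.Quotient.eq_zero_iff_mem] using hxq)
    refine le_trans ?_ h2
    push_cast [List.length_cons]
    gcongr

/-! ### A Cohen-Macaulay criterion for homogeneous quotients of polynomial rings -/

/-- The quotient of `R / I` by the sequence `rs` is `R / (I + (rs))`. -/
noncomputable def quotOfListEquiv {R : Type*} [CommRing R] (I : Ideal R) (rs : List R) :
    ((R ⧸ I) ⧸ (Ideal.ofList rs • ⊤ : Submodule R (R ⧸ I))) ≃ₗ[R] R ⧸ (I ⊔ Ideal.ofList rs) :=
  Submodule.quotEquivOfEq _ _ (by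
    rw [← Submodule.range_mkQ I, ← Submodule.map_top, ← Submodule.map_smul'']; simp) ≪≫ₗ
    Submodule.quotientQuotientEquivQuotientSup I (Ideal.ofList rs)

theorem isSMulRegular_quotient_iff {R : Type*} [CommRing R] (J : Ideal R) (x : R) :
    IsSMulRegular (R ⧸ J) x ↔ ∀ u, x * u ∈ J → u ∈ J := by
  rw [isSMulRegular_iff_right_eq_zero_of_smul]
  refine ⟨fun h u hu => ?_, fun h => ?_⟩
  · rw [← Ideal.Quotient.eq_zero_iff_mem]
    apply h
    rw [← Ideal.Quotient.eq_zero_iff_mem] at hu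
    exact hu
  · intro w hw
    obtain ⟨u, rfl⟩ := Ideal.Quotient.mk_surjective w
    rw [Ideal.Quotient.eq_zero_iff_mem]
    apply h
    rw [← Ideal.Quotient.eq_zero_iff_mem]
    exact hw

open RingTheory.Sequence in
theorem isWeaklyRegular_quotient_append_singleton {R : Type*} [CommRing R] {I : Ideal R}
    {rs : List R} (hrs : IsWeaklyRegular (R ⧸ I) rs) {x : R}
    (hx : ∀ u, x * u ∈ I ⊔ Ideal.ofList rs → u ∈ I ⊔ Ideal.ofList rs) :
    IsWeaklyRegular (R ⧸ I) (rs ++ [x]) := by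
  rw [isWeaklyRegular_append_iff, isWeaklyRegular_singleton_iff]
  refine ⟨hrs, ?_⟩
  rwa [(quotOfListEquiv I rs).isSMulRegular_congr, isSMulRegular_quotient_iff]

namespace MvPolynomial

attribute [local instance] MvPolynomial.gradedAlgebra

theorem homogeneousComponent_mul_of_isHomogeneous {R σ : Type*} [CommSemiring R]
    {f : MvPolynomial σ R} {k : ℕ} (hf : f.IsHomogeneous k) (g : MvPolynomial σ R) (j : ℕ) :
    homogeneousComponent (k + j) (f * g) = f * homogeneousComponent j g := by
  have h := DirectSum.coe_decompose_mul_add_of_left_mem (𝒜 := homogeneousSubmodule σ R) (b := g)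
    (j := j) ((mem_homogeneousSubmodule k f).mpr hf)
  rw [← decomposition.decompose'_apply, ← decomposition.decompose'_apply]
  exact h

theorem homogeneousComponent_mem_of_isHomogeneous {R σ : Type*} [CommSemiring R]
    {J : Ideal (MvPolynomial σ R)} (hJ : J.IsHomogeneous (homogeneousSubmodule σ R))
    {g : MvPolynomial σ R} (hg : g ∈ J) (j : ℕ) : homogeneousComponent j g ∈ J := by
  rw [← decomposition.decompose'_apply]
  exact hJ j hg

/-- A homogeneous element that is a zero divisor modulo a homogeneous ideal lies in an associated
prime contained in the irrelevant ideal. -/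
theorem exists_isAssociatedPrime_of_isHomogeneous {F σ : Type*} [Field F] [Finite σ]
    {J : Ideal (MvPolynomial σ F)} (hJ : J.IsHomogeneous (homogeneousSubmodule σ F))
    {f : MvPolynomial σ F} {k : ℕ} (hf : f.IsHomogeneous k)
    (hreg : ¬ IsSMulRegular (MvPolynomial σ F ⧸ J) f) :
    ∃ p : Ideal (MvPolynomial σ F), IsAssociatedPrime p (MvPolynomial σ F ⧸ J) ∧ f ∈ p ∧ J ≤ p ∧
      p ≤ RingHom.ker (constantCoeff (R := F) (σ := σ)) := by
  rw [isSMulRegular_quotient_iff] at hreg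
  push Not at hreg
  obtain ⟨u, hfu, hu⟩ := hreg
  obtain ⟨j, hj⟩ : ∃ j, homogeneousComponent j u ∉ J := by
    by_contra! h
    exact hu (by rw [← sum_homogeneousComponent u]; exact Ideal.sum_mem _ fun i _ => h i)
  have hfj : f * homogeneousComponent j u ∈ J := by
    rw [← homogeneousComponent_mul_of_isHomogeneous hf]
    exact homogeneousComponent_mem_of_isHomogeneous hJ hfu _
  have := RingHom.ker_isPrime (constantCoeff (R := F) (σ := σ))
  -- An annihilator s of the class of u_j has zero constant term: the degree-j part of s·u_j is s_0
  -- u_j, so s_0 ≠ 0 would put u_j in the homogeneous ideal `J`.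
  obtain ⟨p, hp, h1, h2⟩ := exists_isAssociatedPrime_le
    (q := RingHom.ker (constantCoeff (R := F) (σ := σ)))
    (Ideal.Quotient.mk J (homogeneousComponent j u)) (by
      intro s hs
      have hs' : s * homogeneousComponent j u ∈ J := by
        rw [← Ideal.Quotient.eq_zero_iff_mem]; exact hs
      have h0 := homogeneousComponent_mem_of_isHomogeneous hJ hs' j
      rw [mul_comm] at h0
      have h3 := homogeneousComponent_mul_of_isHomogeneous
        (homogeneousComponent_isHomogeneous j u) s 0
      rw [add_zero] at h3
      rw [h3, homogeneousComponent_zero, mul_comm] at h0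
      by_contra hsm
      refine hj ?_
      have hc : IsUnit (C (σ := σ) (coeff 0 s)) := by
        rw [isUnit_map_iff]
        exact isUnit_iff_ne_zero.mpr hsm
      exact (Ideal.unit_mul_mem_iff_mem J hc).mp h0)
  refine ⟨p, hp, h1 f ?_, fun s hs => h1 s ?_, h2⟩
  · have := Ideal.Quotient.eq_zero_iff_mem.mpr hfj
    exact this
  · have := Ideal.Quotient.eq_zero_iff_mem.mpr (J.mul_mem_right (homogeneousComponent j u) hs)
    exact this

open RingTheory.Sequence in
/-- If `S/I` has a regular sequence of length at least `dim S/I` in the irrelevant ideal, then it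
is Cohen-Macaulay. -/
theorem isCohenMacaulayQuotient_of_isWeaklyRegular {F σ : Type*} [Field F] [Finite σ]
    {I : Ideal (MvPolynomial σ F)} (hI : I.IsHomogeneous (homogeneousSubmodule σ F))
    (hIm : I ≤ RingHom.ker (constantCoeff (R := F) (σ := σ)))
    {rs : List (MvPolynomial σ F)} (hrs : IsWeaklyRegular (MvPolynomial σ F ⧸ I) rs)
    (hmem : ∀ r ∈ rs, r ∈ RingHom.ker (constantCoeff (R := F) (σ := σ)))
    (hdim : ringKrullDim (MvPolynomial σ F ⧸ I) ≤ rs.length) : IsCohenMacaulayQuotient I := by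
  rintro θ ⟨hθ, hlen, hsop⟩
  set m := RingHom.ker (constantCoeff (R := F) (σ := σ)) with hm
  have hmax : m.IsMaximal := RingHom.ker_isMaximal_of_surjective _ fun a => ⟨C a, by simp⟩
  have hmtop : m • (⊤ : Submodule (MvPolynomial σ F) (MvPolynomial σ F ⧸ I)) ≠ ⊤ := by
    intro h
    have h' : (Ideal.Quotient.mk I 1) ∈
        m • (⊤ : Submodule (MvPolynomial σ F) (MvPolynomial σ F ⧸ I)) := by rw [h]; trivial
    rw [← Submodule.range_mkQ I, ← Submodule.map_top, ← Submodule.map_smul''] at h'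
    obtain ⟨y, hy, hy1⟩ := h'
    have h3 : y - 1 ∈ I := Ideal.Quotient.eq.mp hy1
    have h2 : y ∈ m := by simpa using hy
    exact (Ideal.ne_top_iff_one m).mp hmax.ne_top (by simpa using m.sub_mem h2 (hIm h3))
  have hofList : ∀ l : List (MvPolynomial σ F), (∀ r ∈ l, r ∈ m) →
      (⊤ : Submodule (MvPolynomial σ F) (MvPolynomial σ F ⧸ I)) ≠ Ideal.ofList l • ⊤ := by
    intro l hl h
    refine hmtop (top_le_iff.mp ?_)
    conv_lhs => rw [h]
    exact Submodule.smul_mono_left (Ideal.span_le.mpr hl)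
  have hθm : ∀ f ∈ θ, f ∈ m := by
    intro f hf
    obtain ⟨k, hk, hfk⟩ := hθ f hf
    rw [hm, RingHom.mem_ker, constantCoeff_eq]
    exact hfk.coeff_eq_zero (by simpa using hk.ne)
  have hle : θ.length ≤ rs.length := by
    rw [hlen] at hdim
    exact_mod_cast hdim
  have key : ∀ k ≤ θ.length, IsWeaklyRegular (MvPolynomial σ F ⧸ I) (θ.take k) := by
    intro k
    induction k with
    | zero => simp
    | succ k ih =>
      intro hk
      have ihk := ih (by omega)
      have hkl : k < θ.length := by omega
      have hlen_take : (θ.take k).length = k := by simp; omega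
      have htake : θ.take (k + 1) = θ.take k ++ [θ[k]] := by simp
      rw [htake, isWeaklyRegular_append_iff, isWeaklyRegular_singleton_iff]
      refine ⟨ihk, ?_⟩
      -- Depth at least `rs.length - k` survives modulo the first k parameters.
      obtain ⟨rs', h1, h2, h3⟩ := exists_isRegular_quot_ofList m (θ.take k) hmtop
        (fun x hx => hθm x (List.mem_of_mem_take hx)) ihk ⟨hrs, hofList rs hmem⟩ hmem
        (k := rs.length - k) (by omega)
      rw [(quotOfListEquiv I (θ.take k)).isRegular_congr] at h3
      rw [(quotOfListEquiv I (θ.take k)).isSMulRegular_congr]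
      -- A zero divisor θ_{k+1} lies in an associated prime p inside `m`, and then `rs.length - k` ≤
      -- dim S/p ≤ dim S/(I, θ_1, …, θ_{k+1}) = `θ.length - (k + 1)`, contradicting `hle`.
      by_contra hreg
      obtain ⟨d, -, hd⟩ := hθ θ[k] (by simp)
      have hJ : (I ⊔ Ideal.ofList (θ.take k)).IsHomogeneous (homogeneousSubmodule σ F) :=
        hI.sup (Ideal.homogeneous_span _ _ fun f hf => by
          obtain ⟨e, -, he⟩ := hθ f (List.mem_of_mem_take hf)
          exact ⟨e, he⟩)
      obtain ⟨p, hp, hfp, hJp, hpm⟩ := exists_isAssociatedPrime_of_isHomogeneous hJ hd hreg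
      have hdp := hp.length_le_ringKrullDim rs' h3.toIsWeaklyRegular h2 hpm
      have hle' : I ⊔ Ideal.ofList (θ.take (k + 1)) ≤ p := by
        rw [htake, Ideal.ofList_append, Ideal.ofList_singleton, ← sup_assoc]
        exact sup_le hJp ((Ideal.span_singleton_le_iff_mem p).mpr hfp)
      have hd2 := hdp.trans (ringKrullDim_le_of_surjective (Ideal.Quotient.factor hle')
        (Ideal.Quotient.factor_surjective hle'))
      have hd3 := hsop (k + 1) hk
      rw [hlen] at hd3
      have hd4 : ((rs'.length : ℕ) : WithBot ℕ∞) + ((k + 1 : ℕ) : WithBot ℕ∞) ≤ θ.length := by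
        rw [← hd3]
        gcongr
      have hd5 : rs'.length + (k + 1) ≤ θ.length := by exact_mod_cast hd4
      omega
  refine ⟨?_, hofList θ hθm⟩
  simpa using key θ.length le_rfl

end MvPolynomial

/-! ### Stanley-Reisner ideals and monomials -/

namespace FaceComplex

open MvPolynomial

theorem prod_X_eq_monomial {R V : Type*} [CommSemiring R] (F : Finset V) :
    (∏ v ∈ F, X v : MvPolynomial V R) = monomial (∑ v ∈ F, Finsupp.single v 1) 1 := by
  rw [monomial_sum_one]
  rfl

theorem sum_single_one_le_iff {V : Type*} (F : Finset V) (a : V →₀ ℕ) :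
    (∑ v ∈ F, Finsupp.single v 1) ≤ a ↔ F ⊆ a.support := by
  classical
  have h : ∀ w, (∑ v ∈ F, Finsupp.single v 1 : V →₀ ℕ) w = if w ∈ F then 1 else 0 := by
    intro w
    simp [Finsupp.finsetSum_apply, Finsupp.single_apply]
  rw [Finsupp.le_def]
  simp only [h]
  refine forall_congr' fun w => ?_
  by_cases hw : w ∈ F
  · simp [hw, Nat.one_le_iff_ne_zero]
  · simp [hw]

theorem stanleyReisnerIdeal_eq_span_monomial {F V : Type*} [Field F] (Δ : FaceComplex V) :
    Δ.stanleyReisnerIdeal F = Ideal.span ((fun a => monomial a (1 : F)) ''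
      ((fun G : Finset V => ∑ v ∈ G, Finsupp.single v 1) '' Δ.facesᶜ)) := by
  rw [stanleyReisnerIdeal, Set.image_image]
  simp only [prod_X_eq_monomial]

theorem exists_notMem_faces_le_iff {V : Type*} (Δ : FaceComplex V) (a : V →₀ ℕ) :
    (∃ b ∈ (fun G : Finset V => ∑ v ∈ G, Finsupp.single v 1) '' Δ.facesᶜ, b ≤ a) ↔
      a.support ∉ Δ.faces := by
  simp only [Set.exists_mem_image, sum_single_one_le_iff]
  exact ⟨fun ⟨G, hG, hGa⟩ ha => hG (Δ.down_closed ha hGa), fun h => ⟨_, h, subset_rfl⟩⟩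

theorem mem_stanleyReisnerIdeal_iff {F V : Type*} [Field F] (Δ : FaceComplex V)
    (p : MvPolynomial V F) :
    p ∈ Δ.stanleyReisnerIdeal F ↔ ∀ a ∈ p.support, a.support ∉ Δ.faces := by
  rw [stanleyReisnerIdeal_eq_span_monomial, mem_ideal_span_monomial_image]
  simp only [exists_notMem_faces_le_iff]

/-- Adding variables to a monomial ideal leaves it monomial, so membership is tested on each
monomial. This turns the regularity checks below into combinatorics of supports. -/
theorem mem_stanleyReisnerIdeal_sup_iff {F V : Type*} [Field F] (Δ : FaceComplex V)
    (L : List V) (p : MvPolynomial V F) :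
    p ∈ Δ.stanleyReisnerIdeal F ⊔ Ideal.ofList (L.map X) ↔
      ∀ a, coeff a p ≠ 0 → a.support ∈ Δ.faces → ∃ v ∈ L, a v ≠ 0 := by
  have h : Ideal.ofList (L.map (X : V → MvPolynomial V F)) =
      Ideal.span ((fun a => monomial a (1 : F)) '' ((fun v => Finsupp.single v 1) '' {v | v ∈ L})) := by
    rw [Set.image_image]
    refine congrArg Ideal.span (Set.ext fun p => ?_)
    exact List.mem_map
  rw [stanleyReisnerIdeal_eq_span_monomial, h, ← Ideal.span_union, ← Set.image_union,
    mem_ideal_span_monomial_image]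
  refine forall_congr' fun a => ?_
  rw [mem_support_iff]
  refine imp_congr_right fun _ => ?_
  have h2 : (∃ b ∈ (fun v => Finsupp.single v 1) '' {v | v ∈ L}, b ≤ a) ↔ ∃ v ∈ L, a v ≠ 0 := by
    simp [Nat.one_le_iff_ne_zero]
  rw [← h2]
  simp only [Set.mem_union, or_and_right, exists_or, exists_notMem_faces_le_iff]
  tauto

attribute [local instance] MvPolynomial.gradedAlgebra

theorem stanleyReisnerIdeal_isHomogeneous {F V : Type*} [Field F] (Δ : FaceComplex V) :
    (Δ.stanleyReisnerIdeal F).IsHomogeneous (homogeneousSubmodule V F) := by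
  refine Ideal.homogeneous_span _ _ ?_
  rintro _ ⟨G, -, rfl⟩
  exact ⟨_, IsHomogeneous.prod _ _ _ fun v _ => isHomogeneous_X F v⟩

theorem stanleyReisnerIdeal_le_ker {F V : Type*} [Field F] (Δ : FaceComplex V) :
    Δ.stanleyReisnerIdeal F ≤ RingHom.ker (constantCoeff (R := F) (σ := V)) := by
  intro p hp
  rw [mem_stanleyReisnerIdeal_iff] at hp
  by_contra h
  exact hp 0 (by simpa [constantCoeff_eq] using h) (by simpa using Δ.empty_mem)

/-! ### Complexes whose faces contain at most one vertex of a given set -/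

/-- A vertex outside `W` is a cone point: adding it to a support does not affect being a face. -/
theorem X_mul_mem_of_notMem {F V : Type*} [Field F] {Δ : FaceComplex V} {W : Finset V}
    (hΔ : ∀ H, H ∈ Δ.faces ↔ ∀ a ∈ H, ∀ b ∈ H, a ∈ W → b ∈ W → a = b) {L : List V} {v : V}
    (hv : v ∉ W) (hvL : v ∉ L) (u : MvPolynomial V F)
    (hu : X v * u ∈ Δ.stanleyReisnerIdeal F ⊔ Ideal.ofList (L.map X)) :
    u ∈ Δ.stanleyReisnerIdeal F ⊔ Ideal.ofList (L.map X) := by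
  classical
  rw [mem_stanleyReisnerIdeal_sup_iff] at hu ⊢
  intro a ha haΔ
  obtain ⟨w, hwL, hw⟩ := hu (Finsupp.single v 1 + a) (by rwa [coeff_X_mul]) (by
    rw [hΔ] at haΔ ⊢
    have key : ∀ c, c ∈ (Finsupp.single v 1 + a).support → c ∈ W → c ∈ a.support := by
      intro c hc hcW
      have : v ≠ c := fun h => hv (h ▸ hcW)
      simpa [Finsupp.single_apply, this] using hc
    exact fun b hb c hc hbW hcW => haΔ b (key b hb hbW) c (key c hc hcW) hbW hcW)
  have : v ≠ w := fun h => hvL (h ▸ hwL)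
  exact ⟨w, hwL, by simpa [Finsupp.single_apply, this] using hw⟩

open RingTheory.Sequence in
theorem isWeaklyRegular_map_X {F V : Type*} [Field F] {Δ : FaceComplex V} {W : Finset V}
    (hΔ : ∀ H, H ∈ Δ.faces ↔ ∀ a ∈ H, ∀ b ∈ H, a ∈ W → b ∈ W → a = b) {L : List V}
    (hL : ∀ v ∈ L, v ∉ W) (hLn : L.Nodup) :
    IsWeaklyRegular (MvPolynomial V F ⧸ Δ.stanleyReisnerIdeal F) (L.map (X : V → MvPolynomial V F)) := by
  induction L using List.reverseRecOn with
  | nil => simp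
  | append_singleton L v ih =>
    rw [List.nodup_append] at hLn
    rw [List.map_append]
    refine isWeaklyRegular_quotient_append_singleton (ih (fun w hw => hL w (by simp [hw])) hLn.1)
      (X_mul_mem_of_notMem hΔ (hL v (by simp)) fun hv => hLn.2.2 v hv v (by simp) rfl)

/-- For a monomial x^a supported on a face, let b be the vertex of `W` in its support, or any vertex
of `W` if there is none. Then x_b x^a is still supported on a face, and no other x_c with c in `W`
divides it, so its coefficient in the product equals that of x^a in `u`. -/
theorem sum_X_mul_mem {F V : Type*} [Field F] {Δ : FaceComplex V} {W : Finset V}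
    (hΔ : ∀ H, H ∈ Δ.faces ↔ ∀ a ∈ H, ∀ b ∈ H, a ∈ W → b ∈ W → a = b) (hW : W.Nonempty)
    {L : List V} (hL : ∀ v ∈ L, v ∉ W) (u : MvPolynomial V F)
    (hu : (∑ c ∈ W, X c) * u ∈ Δ.stanleyReisnerIdeal F ⊔ Ideal.ofList (L.map X)) :
    u ∈ Δ.stanleyReisnerIdeal F ⊔ Ideal.ofList (L.map X) := by
  classical
  rw [mem_stanleyReisnerIdeal_sup_iff] at hu ⊢
  intro a ha haΔ
  rw [hΔ] at haΔ
  obtain ⟨b, hbW, hb⟩ : ∃ b ∈ W, ∀ c ∈ W, a c ≠ 0 → c = b := by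
    by_cases h : ∃ b ∈ W, a b ≠ 0
    · obtain ⟨b, hbW, hb⟩ := h
      exact ⟨b, hbW, fun c hc hca => haΔ c (by simpa using hca) b (by simpa using hb) hc hbW⟩
    · push Not at h
      obtain ⟨b, hb⟩ := hW
      exact ⟨b, hb, fun c hc hca => absurd (h c hc) hca⟩
  have hsupp : ∀ c ∈ W, c ∈ (Finsupp.single b 1 + a).support → c = b := by
    intro c hc hca
    by_contra hcb
    exact hcb (hb c hc (by simpa [Finsupp.single_apply, Ne.symm hcb] using hca))
  obtain ⟨w, hwL, hw⟩ := hu (Finsupp.single b 1 + a) (by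
    rw [Finset.sum_mul, coeff_sum, Finset.sum_eq_single b]
    · rwa [coeff_X_mul]
    · intro c hc hcb
      rw [coeff_X_mul', if_neg fun h => hcb (hsupp c hc h)]
    · exact fun h => absurd hbW h) (by
    rw [hΔ]
    exact fun c hc d hd hcW hdW => (hsupp c hcW hc).trans (hsupp d hdW hd).symm)
  have : b ≠ w := fun h => hL w hwL (h ▸ hbW)
  exact ⟨w, hwL, by simpa [Finsupp.single_apply, this] using hw⟩

end FaceComplex

/-! ### Krull dimension and the Cohen–Macaulay property -/

theorem ringKrullDim_le_of_forall_prime {R : Type*} [CommRing R] {N : WithBot ℕ∞}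
    (h : ∀ q : Ideal R, q.IsPrime → ringKrullDim (R ⧸ q) ≤ N) : ringKrullDim R ≤ N := by
  rw [ringKrullDim, Order.krullDim_eq_iSup_coheight]
  refine iSup_le fun q => ?_
  rw [Order.coheight_eq_krullDim_Ici]
  refine le_trans (le_of_eq ?_) (h q.asIdeal q.2)
  rw [ringKrullDim_quotient]
  rfl

namespace FaceComplex

open MvPolynomial

/-- In a quotient domain the relations x_a x_b = 0 leave at most one nonzero variable from `W`, so
the domain is a quotient of a polynomial ring in |Wᶜ| + 1 variables. -/
theorem ringKrullDim_stanleyReisner_le {F V : Type*} [Field F] [Fintype V] [DecidableEq V]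
    {Δ : FaceComplex V} {W : Finset V}
    (hΔ : ∀ H, H ∈ Δ.faces ↔ ∀ a ∈ H, ∀ b ∈ H, a ∈ W → b ∈ W → a = b) (hW : W.Nonempty) :
    ringKrullDim (MvPolynomial V F ⧸ Δ.stanleyReisnerIdeal F) ≤ ((Wᶜ.card + 1 : ℕ) : WithBot ℕ∞) := by
  refine ringKrullDim_le_of_forall_prime fun q hq => ?_
  let f : MvPolynomial V F →ₐ[F] (MvPolynomial V F ⧸ Δ.stanleyReisnerIdeal F) ⧸ q :=
    (Ideal.Quotient.mkₐ F q).comp (Ideal.Quotient.mkₐ F (Δ.stanleyReisnerIdeal F))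
  have hf : Function.Surjective f :=
    (Ideal.Quotient.mkₐ_surjective F q).comp (Ideal.Quotient.mkₐ_surjective F _)
  have hzero : ∀ a ∈ W, ∀ b ∈ W, a ≠ b → f (X a) ≠ 0 → f (X b) = 0 := by
    intro a ha b hb hab hfa
    have h1 : X a * X b ∈ Δ.stanleyReisnerIdeal F := by
      refine Ideal.subset_span ⟨{a, b}, ?_, by simp [Finset.prod_pair hab]⟩
      rw [Set.mem_compl_iff, hΔ]
      exact fun h => hab (h a (by simp) b (by simp) ha hb)
    have h2 : f (X a * X b) = 0 := by
      simp only [f, AlgHom.comp_apply]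
      rw [Ideal.Quotient.mkₐ_eq_mk, Ideal.Quotient.mkₐ_eq_mk,
        Ideal.Quotient.eq_zero_iff_mem.mpr h1, map_zero]
    rw [map_mul] at h2
    exact (mul_eq_zero.mp h2).resolve_left hfa
  obtain ⟨a, haW, ha⟩ : ∃ a ∈ W, ∀ b ∈ W, b ≠ a → f (X b) = 0 := by
    by_cases h : ∃ a ∈ W, f (X a) ≠ 0
    · obtain ⟨a, ha, hfa⟩ := h
      exact ⟨a, ha, fun b hb hba => hzero a ha b hb hba.symm hfa⟩
    · push Not at h
      obtain ⟨a, ha⟩ := hW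
      exact ⟨a, ha, fun b hb _ => h b hb⟩
  let g : MvPolynomial {v // v ∈ insert a Wᶜ} F →ₐ[F] _ := aeval fun v => f (X v.1)
  have hg : Function.Surjective g := by
    rw [← AlgHom.range_eq_top, ← top_le_iff, ← (AlgHom.range_eq_top f).mpr hf,
      ← Algebra.map_top f, ← adjoin_range_X, AlgHom.map_adjoin, Algebra.adjoin_le_iff]
    rintro _ ⟨_, ⟨v, rfl⟩, rfl⟩
    by_cases hv : v ∈ insert a Wᶜ
    · exact ⟨X ⟨v, hv⟩, by simp [g]⟩
    · simp only [Finset.mem_insert, Finset.mem_compl, not_or, not_not] at hv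
      rw [ha v hv.2 hv.1]
      exact zero_mem _
  have h := ringKrullDim_le_of_surjective g.toRingHom hg
  rw [MvPolynomial.ringKrullDim_of_isNoetherianRing, ringKrullDim_eq_zero_of_field, zero_add,
    Nat.card_eq_fintype_card, Fintype.card_coe, Finset.card_insert_of_notMem (by simpa using haW)] at h
  exact h

/-- The regular sequence consists of the variables outside `W` and the sum of those in `W`. Its
length matches the upper bound on the dimension, so no lower bound is needed. -/
theorem isCohenMacaulay_of_forall_mem_faces_iff {F V : Type*} [Field F] [Fintype V] [DecidableEq V]
    {Δ : FaceComplex V} {W : Finset V}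
    (hΔ : ∀ H, H ∈ Δ.faces ↔ ∀ a ∈ H, ∀ b ∈ H, a ∈ W → b ∈ W → a = b) (hW : W.Nonempty) :
    Δ.IsCohenMacaulay F := by
  have hL : ∀ v ∈ Wᶜ.toList, v ∉ W := fun v hv => by simpa using hv
  refine isCohenMacaulayQuotient_of_isWeaklyRegular Δ.stanleyReisnerIdeal_isHomogeneous
    Δ.stanleyReisnerIdeal_le_ker
    (isWeaklyRegular_quotient_append_singleton (isWeaklyRegular_map_X hΔ hL Wᶜ.nodup_toList)
      (sum_X_mul_mem hΔ hW hL)) ?_ ?_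
  · intro r hr
    simp only [List.mem_append, List.mem_map, List.mem_singleton] at hr
    rcases hr with ⟨v, -, rfl⟩ | rfl <;> simp [RingHom.mem_ker]
  · refine (ringKrullDim_stanleyReisner_le hΔ hW).trans (le_of_eq ?_)
    simp

end FaceComplex

/-! ### Coefficients in Stanley-Reisner rings -/

namespace FaceComplex

open MvPolynomial

open scoped Classical in
/-- The coefficient of a monomial supported on a face, as a functional on the Stanley-Reisner
ring. -/
noncomputable def coeffQuot (F : Type*) [Field F] {V : Type*} (Δ : FaceComplex V) (a : V →₀ ℕ) :
    (MvPolynomial V F ⧸ Δ.stanleyReisnerIdeal F) →ₗ[F] F :=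
  if h : a.support ∈ Δ.faces then
    ((Δ.stanleyReisnerIdeal F).restrictScalars F).liftQ (lcoeff F a) (by
      intro p hp
      by_contra hc
      exact (Δ.mem_stanleyReisnerIdeal_iff p).mp hp a (by simpa using hc) h) ∘ₗ
    (Submodule.Quotient.restrictScalarsEquiv F (Δ.stanleyReisnerIdeal F)).symm.toLinearMap
  else 0

section

variable {F V : Type*} [Field F] {Δ : FaceComplex V}

theorem coeffQuot_mk {a : V →₀ ℕ} (ha : a.support ∈ Δ.faces) (p : MvPolynomial V F) :
    Δ.coeffQuot F a (Ideal.Quotient.mk _ p) = coeff a p := by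
  rw [coeffQuot, dif_pos ha]
  rfl

theorem quot_ext {x y : MvPolynomial V F ⧸ Δ.stanleyReisnerIdeal F}
    (h : ∀ a : V →₀ ℕ, a.support ∈ Δ.faces → Δ.coeffQuot F a x = Δ.coeffQuot F a y) : x = y := by
  obtain ⟨p, rfl⟩ := Ideal.Quotient.mk_surjective x
  obtain ⟨q, rfl⟩ := Ideal.Quotient.mk_surjective y
  rw [Ideal.Quotient.eq, mem_stanleyReisnerIdeal_iff]
  intro a ha haΔ
  have := h a haΔ
  rw [coeffQuot_mk haΔ, coeffQuot_mk haΔ] at this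
  simp [this] at ha

theorem coeffQuot_X_smul [DecidableEq V] {a : V →₀ ℕ} (ha : a.support ∈ Δ.faces) (k : ℕ) (v : V)
    (x : MvPolynomial V F ⧸ Δ.stanleyReisnerIdeal F) :
    Δ.coeffQuot F a (((-1) ^ k * X v : MvPolynomial V F) • x) =
      (-1) ^ k * if v ∈ a.support then Δ.coeffQuot F (a - Finsupp.single v 1) x else 0 := by
  obtain ⟨p, rfl⟩ := Ideal.Quotient.mk_surjective x
  have h : ((-1) ^ k * X v : MvPolynomial V F) •
      Ideal.Quotient.mk (Δ.stanleyReisnerIdeal F) p =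
      Ideal.Quotient.mk (Δ.stanleyReisnerIdeal F) (C ((-1) ^ k) * (X v * p)) := by
    have h' : (C ((-1) ^ k) : MvPolynomial V F) = (-1) ^ k := by simp
    rw [h', ← mul_assoc]
    rfl
  have ha' : (a - Finsupp.single v 1).support ∈ Δ.faces :=
    Δ.down_closed ha (Finsupp.support_mono tsub_le_self)
  rw [h, coeffQuot_mk ha, coeffQuot_mk ha', coeff_C_mul, coeff_X_mul']

theorem coeffQuot_eq_zero_of_mem_quotientDegree {k : ℕ}
    {x : MvPolynomial V F ⧸ Δ.stanleyReisnerIdeal F}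
    (hx : x ∈ quotientDegree (Δ.stanleyReisnerIdeal F) k) {a : V →₀ ℕ} (ha : a.support ∈ Δ.faces)
    (hak : a.degree ≠ k) : Δ.coeffQuot F a x = 0 := by
  obtain ⟨p, hp, rfl⟩ := hx
  exact (coeffQuot_mk ha p).trans (IsHomogeneous.coeff_eq_zero hp hak)

theorem quotientDegree_one_ext {x y : MvPolynomial V F ⧸ Δ.stanleyReisnerIdeal F}
    (hx : x ∈ quotientDegree (Δ.stanleyReisnerIdeal F) 1)
    (hy : y ∈ quotientDegree (Δ.stanleyReisnerIdeal F) 1)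
    (h : ∀ v, Δ.coeffQuot F (Finsupp.single v 1) x = Δ.coeffQuot F (Finsupp.single v 1) y) :
    x = y := by
  refine quot_ext fun a ha => ?_
  by_cases hd : a.degree = 1
  · obtain ⟨v, rfl⟩ := (Finsupp.sum_eq_one_iff a).mp hd
    exact h v
  · rw [coeffQuot_eq_zero_of_mem_quotientDegree hx ha hd,
      coeffQuot_eq_zero_of_mem_quotientDegree hy ha hd]

theorem smul_mk_X_mem_quotientDegree (I : Ideal (MvPolynomial V F)) (c : F) (v : V) :
    c • Ideal.Quotient.mk I (X v) ∈ quotientDegree I 1 :=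
  Submodule.smul_mem _ _ ⟨X v, isHomogeneous_X F v, rfl⟩

theorem smul_one_mem_quotientDegree (I : Ideal (MvPolynomial V F)) (c : F) :
    c • (1 : MvPolynomial V F ⧸ I) ∈ quotientDegree I 0 :=
  Submodule.smul_mem _ _ ⟨1, isHomogeneous_one V F, rfl⟩

theorem neg_one_pow_mul_X_smul (I : Ideal (MvPolynomial V F)) (k : ℕ) (c : F) (v : V) :
    ((-1) ^ k * X v : MvPolynomial V F) • (c • (1 : MvPolynomial V F ⧸ I)) =
      ((-1) ^ k * c) • Ideal.Quotient.mk I (X v) := by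
  have h : ((-1) ^ k * X v : MvPolynomial V F) = ((-1) ^ k : F) • X v := by
    simp [smul_eq_C_mul]
  rw [smul_comm, h, smul_assoc, smul_smul, mul_comm]
  congr 1
  exact mul_one (Ideal.Quotient.mk I (X v))

end

/-! ### The linear strand of the Koszul homology -/

section Koszul

variable {F : Type*} [Field F] {n : ℕ}

theorem mem_koszulPart_succ_iff {I : Ideal (MvPolynomial (Fin n) F)} {i j : ℕ}
    {f : Finset (Fin n) → MvPolynomial (Fin n) F ⧸ I} :
    f ∈ koszulPart I i (i + j) ↔
      ∀ G, (G.card = i → f G ∈ quotientDegree I j) ∧ (G.card ≠ i → f G = 0) := by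
  simp only [koszulPart, Submodule.mem_pi, Set.mem_univ, true_implies]
  refine forall_congr' fun G => ?_
  by_cases h : G.card = i <;> simp [h]

/-- The coefficient of `x_v e_{T ∖ v}`, with the sign of the Koszul differential. -/
noncomputable def strandCoeff (F : Type*) [Field F] (Δ : FaceComplex (Fin n)) (T : Finset (Fin n))
    (v : Fin n) :
    (Finset (Fin n) → MvPolynomial (Fin n) F ⧸ Δ.stanleyReisnerIdeal F) →ₗ[F] F :=
  ((-1 : F) ^ ((T.erase v).filter (· < v)).card) •
    (Δ.coeffQuot F (Finsupp.single v 1) ∘ₗ LinearMap.proj (T.erase v))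

theorem strandCoeff_insert (Δ : FaceComplex (Fin n)) {G : Finset (Fin n)} {v : Fin n} (hv : v ∉ G)
    (f : Finset (Fin n) → MvPolynomial (Fin n) F ⧸ Δ.stanleyReisnerIdeal F) :
    strandCoeff F Δ (insert v G) v f =
      (-1) ^ (G.filter (· < v)).card * Δ.coeffQuot F (Finsupp.single v 1) (f G) := by
  simp [strandCoeff, Finset.erase_insert hv]

theorem neg_one_pow_mul_self (R : Type*) [CommRing R] (k : ℕ) : (-1 : R) ^ k * (-1) ^ k = 1 := by
  rw [← mul_pow]; simp

theorem coeffQuot_single_eq (Δ : FaceComplex (Fin n)) {G : Finset (Fin n)} {v : Fin n} (hv : v ∉ G)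
    (f : Finset (Fin n) → MvPolynomial (Fin n) F ⧸ Δ.stanleyReisnerIdeal F) :
    Δ.coeffQuot F (Finsupp.single v 1) (f G) =
      (-1) ^ (G.filter (· < v)).card * strandCoeff F Δ (insert v G) v f := by
  rw [strandCoeff_insert Δ hv, ← mul_assoc, neg_one_pow_mul_self, one_mul]

variable {Δ : FaceComplex (Fin n)}

theorem coeffQuot_koszulD (f : Finset (Fin n) → MvPolynomial (Fin n) F ⧸ Δ.stanleyReisnerIdeal F)
    (G : Finset (Fin n)) {a : Fin n →₀ ℕ} (ha : a.support ∈ Δ.faces) :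
    Δ.coeffQuot F a (koszulD F n _ f G) = ∑ u ∈ Gᶜ, (-1) ^ (G.filter (· < u)).card *
      if u ∈ a.support then Δ.coeffQuot F (a - Finsupp.single u 1) (f (insert u G)) else 0 := by
  rw [koszulD_apply, map_sum]
  exact Finset.sum_congr rfl fun u _ => coeffQuot_X_smul ha _ _ _

/-- Only the constant term of `h` at `insert v G` can produce x_v e_G; none does when v is in `G`.
-/
theorem coeffQuot_single_koszulD (hv : ∀ v, {v} ∈ Δ.faces)
    (h : Finset (Fin n) → MvPolynomial (Fin n) F ⧸ Δ.stanleyReisnerIdeal F)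
    (G : Finset (Fin n)) (v : Fin n) :
    Δ.coeffQuot F (Finsupp.single v 1) (koszulD F n _ h G) = if v ∈ G then 0 else
      (-1) ^ (G.filter (· < v)).card * Δ.coeffQuot F 0 (h (insert v G)) := by
  rw [coeffQuot_koszulD _ _ (by simpa [Finsupp.support_single] using hv v)]
  simp only [Finsupp.support_single _ one_ne_zero, Finset.mem_singleton, mul_ite, mul_zero]
  rw [Finset.sum_ite_eq']
  simp only [Finset.mem_compl, tsub_self]
  split_ifs <;> simp_all

/-- The monomial x_v² at e_{G∖v} in the differential comes only from x_v e_G, and x_v² is nonzero in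
the ring. -/
theorem coeffQuot_single_eq_zero_of_mem (hv : ∀ v, {v} ∈ Δ.faces)
    {f : Finset (Fin n) → MvPolynomial (Fin n) F ⧸ Δ.stanleyReisnerIdeal F}
    (hf : koszulD F n _ f = 0) {G : Finset (Fin n)} {v : Fin n} (hvG : v ∈ G) :
    Δ.coeffQuot F (Finsupp.single v 1) (f G) = 0 := by
  have h := coeffQuot_koszulD f (G.erase v) (a := Finsupp.single v 2)
    (by simpa [Finsupp.support_single] using hv v)
  rw [hf, Pi.zero_apply, map_zero] at h
  simp only [Finsupp.support_single _ two_ne_zero, Finset.mem_singleton, mul_ite,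
    mul_zero] at h
  rw [Finset.sum_ite_eq', if_pos (by simp), Finset.insert_erase hvG, ← Finsupp.single_tsub] at h
  exact (mul_eq_zero.mp h.symm).resolve_left (pow_ne_zero _ (by simp))

/-- Put G = T∖{u,v}. The coefficient of x_u x_v at e_G in the differential has two contributions,
from x_u e_{T∖u} and x_v e_{T∖v}. The sign normalisation makes it plus or minus the difference of
the two strand coefficients, and x_u x_v is nonzero because {u,v} is a face. -/
theorem strandCoeff_eq_of_mem_faces
    {f : Finset (Fin n) → MvPolynomial (Fin n) F ⧸ Δ.stanleyReisnerIdeal F}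
    (hf : koszulD F n _ f = 0) {T : Finset (Fin n)} {u v : Fin n} (hu : u ∈ T) (hv : v ∈ T)
    (huv : {u, v} ∈ Δ.faces) : strandCoeff F Δ T u f = strandCoeff F Δ T v f := by
  by_cases hne : u = v
  · rw [hne]
  obtain ⟨G, huG, hvG, rfl⟩ : ∃ G, u ∉ G ∧ v ∉ G ∧ T = insert u (insert v G) :=
    ⟨(T.erase u).erase v, by simp, by simp, by
      rw [Finset.insert_erase (by simp [hv, Ne.symm hne]), Finset.insert_erase hu]⟩
  have hsupp : (Finsupp.single u 1 + Finsupp.single v 1 : Fin n →₀ ℕ).support = {u, v} := by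
    ext w
    simp only [Finsupp.mem_support_iff, Finsupp.coe_add, Pi.add_apply, Finsupp.single_apply,
      Finset.mem_insert, Finset.mem_singleton]
    split_ifs <;> simp_all
    grind
  have h := coeffQuot_koszulD f G (a := Finsupp.single u 1 + Finsupp.single v 1)
    (by rwa [hsupp])
  rw [hf, Pi.zero_apply, map_zero, hsupp] at h
  have hsub : ({u, v} : Finset (Fin n)) ⊆ Gᶜ := by
    intro w hw
    simp only [Finset.mem_insert, Finset.mem_singleton] at hw
    rcases hw with rfl | rfl <;> simpa
  simp only [mul_ite, mul_zero] at h
  rw [Finset.sum_ite_mem, Finset.inter_eq_right.mpr hsub, Finset.sum_pair hne,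
    add_tsub_cancel_left, add_tsub_cancel_right,
    coeffQuot_single_eq Δ (v := v) (G := insert u G) (by simp [hvG, Ne.symm hne]),
    coeffQuot_single_eq Δ (v := u) (G := insert v G) (by simp [huG, hne]),
    Finset.insert_comm v u] at h
  have hs := koszul_sign_swap (R := F) G u v huG hvG hne
  have hk1 := neg_one_pow_mul_self F (G.filter (· < u)).card
  have hk2 := neg_one_pow_mul_self F ((insert u G).filter (· < v)).card
  have h0 : ((-1 : F) ^ (G.filter (· < u)).card * (-1) ^ ((insert u G).filter (· < v)).card) *
      (strandCoeff F Δ (insert u (insert v G)) v f -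
        strandCoeff F Δ (insert u (insert v G)) u f) = 0 := by
    linear_combination -h - strandCoeff F Δ (insert u (insert v G)) u f * hs
  have h1 := (mul_eq_zero.mp h0).resolve_left
    (mul_ne_zero (pow_ne_zero _ (by simp)) (pow_ne_zero _ (by simp)))
  exact (sub_eq_zero.mp h1).symm

end Koszul

end FaceComplex

/-! ### Cycles modulo boundaries in the linear strand -/

namespace FaceComplex

open MvPolynomial

section Koszul

variable {F : Type*} [Field F] {n : ℕ} {Δ : FaceComplex (Fin n)} {W : Finset (Fin n)}

/-- The preimage is the sum of the g(T) e_T: the signed coefficients of the differential of e_T are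
all 1. -/
theorem exists_koszulD_eq_of_strandCoeff_eq (hv : ∀ v, {v} ∈ Δ.faces) {i : ℕ}
    {f : Finset (Fin n) → MvPolynomial (Fin n) F ⧸ Δ.stanleyReisnerIdeal F}
    (hf : f ∈ koszulCycles (Δ.stanleyReisnerIdeal F) i (i + 1)) (g : Finset (Fin n) → F)
    (hg : ∀ T : Finset (Fin n), T.card = i + 1 → ∀ v ∈ T, strandCoeff F Δ T v f = g T) :
    f ∈ koszulBoundaries (Δ.stanleyReisnerIdeal F) i (i + 1) := by
  obtain ⟨hfp, hfd⟩ := hf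
  have hfd' : koszulD F n _ f = 0 := hfd
  have hfp := mem_koszulPart_succ_iff.mp hfp
  let h : Finset (Fin n) → MvPolynomial (Fin n) F ⧸ Δ.stanleyReisnerIdeal F :=
    fun T => (if T.card = i + 1 then g T else 0) • 1
  have hh : h ∈ koszulPart (Δ.stanleyReisnerIdeal F) (i + 1) (i + 1) := by
    rw [show koszulPart (Δ.stanleyReisnerIdeal F) (i + 1) (i + 1) =
      koszulPart (Δ.stanleyReisnerIdeal F) (i + 1) (i + 1 + 0) from rfl, mem_koszulPart_succ_iff]
    exact fun G => ⟨fun _ => smul_one_mem_quotientDegree _ _, fun hG => by simp [h, hG]⟩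
  refine ⟨h, hh, funext fun G => ?_⟩
  change koszulD F n _ h G = f G
  have hD : koszulD F n _ h G = ∑ v ∈ Gᶜ, ((-1) ^ (G.filter (· < v)).card *
      if (insert v G).card = i + 1 then g (insert v G) else 0) • Ideal.Quotient.mk _ (X v) := by
    rw [koszulD_apply]
    exact Finset.sum_congr rfl fun v _ => neg_one_pow_mul_X_smul _ _ _ _
  by_cases hG : G.card = i
  · refine quotientDegree_one_ext ?_ ((hfp G).1 hG) fun v => ?_
    · rw [hD]
      exact Submodule.sum_mem _ fun v _ => smul_mk_X_mem_quotientDegree _ _ _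
    rw [coeffQuot_single_koszulD hv]
    split_ifs with hvG
    · exact (coeffQuot_single_eq_zero_of_mem hv hfd' hvG).symm
    · have hcard : (insert v G).card = i + 1 := by rw [Finset.card_insert_of_notMem hvG, hG]
      rw [coeffQuot_single_eq Δ hvG, hg _ hcard v (by simp)]
      simp only [h, hcard, if_true, map_smul]
      have h1 : Δ.coeffQuot F 0 1 = 1 := by
        rw [← map_one (Ideal.Quotient.mk _), coeffQuot_mk (by simpa using Δ.empty_mem)]
        simp
      rw [h1, smul_eq_mul, mul_one]
  · rw [(hfp G).2 hG, hD]
    refine Finset.sum_eq_zero fun v hv => ?_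
    rw [Finset.card_insert_of_notMem (by simpa using hv), if_neg (by omega), mul_zero, zero_smul]

/-- The common value is the constant term at `T` of any preimage. -/
theorem strandCoeff_of_mem_koszulBoundaries (hv : ∀ v, {v} ∈ Δ.faces) {i j : ℕ}
    {f : Finset (Fin n) → MvPolynomial (Fin n) F ⧸ Δ.stanleyReisnerIdeal F}
    (hf : f ∈ koszulBoundaries (Δ.stanleyReisnerIdeal F) i j) {T : Finset (Fin n)} {u v : Fin n}
    (hu : u ∈ T) (hvT : v ∈ T) : strandCoeff F Δ T u f = strandCoeff F Δ T v f := by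
  obtain ⟨h, -, rfl⟩ := hf
  have key : ∀ w ∈ T, strandCoeff F Δ T w (koszulD F n _ h) = Δ.coeffQuot F 0 (h T) := by
    intro w hw
    conv_lhs => rw [← Finset.insert_erase hw]
    rw [strandCoeff_insert Δ (by simp), coeffQuot_single_koszulD hv, if_neg (by simp),
      ← mul_assoc, neg_one_pow_mul_self, one_mul, Finset.insert_erase hw]
  exact (key u hu).trans (key v hvT).symm

/-- Within `W` the cycle condition is void, because x_u x_v = 0 for distinct u, v there. Hence
coefficients supported on (i+1)-subsets of `W` can be prescribed freely. -/
theorem exists_mem_koszulCycles_strandCoeff_eq (hv : ∀ v, {v} ∈ Δ.faces)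
    (hW : ∀ u ∈ W, ∀ v ∈ W, u ≠ v → {u, v} ∉ Δ.faces) {i : ℕ} (φ : Finset (Fin n) → Fin n → F)
    (hφ : ∀ T v, φ T v ≠ 0 → T ⊆ W ∧ T.card = i + 1) :
    ∃ f ∈ koszulCycles (Δ.stanleyReisnerIdeal F) i (i + 1),
      ∀ T, ∀ v ∈ T, strandCoeff F Δ T v f = φ T v := by
  let f : Finset (Fin n) → MvPolynomial (Fin n) F ⧸ Δ.stanleyReisnerIdeal F := fun G =>
    ∑ v ∈ Gᶜ, ((-1) ^ (G.filter (· < v)).card * φ (insert v G) v) • Ideal.Quotient.mk _ (X v)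
  refine ⟨f, ⟨?_, ?_⟩, fun T v hvT => ?_⟩
  · refine mem_koszulPart_succ_iff.mpr fun G => ⟨fun _ => Submodule.sum_mem _ fun v _ => smul_mk_X_mem_quotientDegree _ _ _,
      fun hG => Finset.sum_eq_zero fun v hv => ?_⟩
    have : φ (insert v G) v = 0 := by
      by_contra h
      have := (hφ _ _ h).2
      rw [Finset.card_insert_of_notMem (by simpa using hv)] at this
      omega
    rw [this, mul_zero, zero_smul]
  · change koszulD F n _ f = 0
    funext G
    rw [koszulD_apply]
    refine Finset.sum_eq_zero fun u hu => ?_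
    rw [Finset.smul_sum]
    refine Finset.sum_eq_zero fun v hv => ?_
    by_cases h : φ (insert v (insert u G)) v = 0
    · simp [h]
    · have hT := (hφ _ _ h).1
      simp only [Finset.mem_compl, Finset.mem_insert, not_or] at hv
      have hmem : X u * X v ∈ Δ.stanleyReisnerIdeal F :=
        Ideal.subset_span ⟨{u, v}, hW u (hT (by simp)) v (hT (by simp)) (Ne.symm hv.1),
          by simp [Finset.prod_pair (Ne.symm hv.1)]⟩
      have h0 : (X u : MvPolynomial (Fin n) F) • Ideal.Quotient.mk (Δ.stanleyReisnerIdeal F) (X v) =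
          0 := Ideal.Quotient.eq_zero_iff_mem.mpr hmem
      rw [mul_smul, smul_comm (X u : MvPolynomial (Fin n) F), h0, smul_zero, smul_zero]
  · conv_lhs => rw [← Finset.insert_erase hvT]
    rw [strandCoeff_insert Δ (by simp)]
    have hcoef : Δ.coeffQuot F (Finsupp.single v 1) (f (T.erase v)) =
        (-1) ^ ((T.erase v).filter (· < v)).card * φ T v := by
      simp only [f, map_sum, map_smul, smul_eq_mul]
      rw [Finset.sum_eq_single v]
      · rw [coeffQuot_mk (by simpa [Finsupp.support_single] using hv v), Finset.insert_erase hvT]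
        simp
      · intro w _ hwv
        rw [coeffQuot_mk (by simpa [Finsupp.support_single] using hv v), coeff_X, if_neg, mul_zero]
        simpa [Finsupp.single_left_inj] using hwv
      · intro h; simp at h
    rw [hcoef, ← mul_assoc, neg_one_pow_mul_self, one_mul]

theorem gradedBetti_succ_of_forall_mem_faces_iff
    (hΔ : ∀ H, H ∈ Δ.faces ↔ ∀ a ∈ H, ∀ b ∈ H, a ∈ W → b ∈ W → a = b) (hW : W.Nonempty) (i : ℕ) :
    gradedBetti (Δ.stanleyReisnerIdeal F) i (i + 1) = i * W.card.choose (i + 1) := by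
  have hv : ∀ v, {v} ∈ Δ.faces := fun v => by
    rw [hΔ]
    intro a ha b hb _ _
    rw [Finset.mem_singleton.mp ha, Finset.mem_singleton.mp hb]
  have hne : ∀ u ∈ W, ∀ v ∈ W, u ≠ v → {u, v} ∉ Δ.faces := fun u hu v hv huv h =>
    huv ((hΔ _).mp h u (by simp) v (by simp) hu hv)
  have hface : ∀ u v, u ∉ W → {u, v} ∈ Δ.faces := by
    intro u v hu
    rw [hΔ]
    intro a ha b hb haW hbW
    simp only [Finset.mem_insert, Finset.mem_singleton] at ha hb
    rcases ha with rfl | rfl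
    · exact absurd haW hu
    · rcases hb with rfl | rfl
      · exact absurd hbW hu
      · rfl
  -- A base vertex in each `T`: functions on `T` modulo constants are then coordinatised by
  -- differences with the value at `b T`, one for each of the i other vertices.
  obtain ⟨b, hb⟩ : ∃ b : Finset (Fin n) → Fin n, ∀ T, T.Nonempty → b T ∈ T := by
    have : Nonempty (Fin n) := ⟨hW.choose⟩
    refine Classical.skolem (p := fun (T : Finset (Fin n)) b => T.Nonempty → b ∈ T) |>.mp fun T => ?_
    by_cases hT : T.Nonempty
    · exact ⟨hT.choose, fun _ => hT.choose_spec⟩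
    · exact ⟨Classical.arbitrary _, fun h => absurd h hT⟩
  let ι : Finset (Σ _ : Finset (Fin n), Fin n) :=
    (W.powersetCard (i + 1)).sigma fun T => T.erase (b T)
  have hι : ∀ p : ι, p.1.1 ⊆ W ∧ p.1.1.card = i + 1 ∧ p.1.2 ≠ b p.1.1 ∧ p.1.2 ∈ p.1.1 := by
    intro p
    have := p.2
    simpa only [ι, Finset.mem_sigma, Finset.mem_powersetCard, Finset.mem_erase, and_assoc] using this
  have hbT : ∀ T : Finset (Fin n), T.card = i + 1 → b T ∈ T := fun T hT =>
    hb T (Finset.card_pos.mp (by omega))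
  let Φ : koszulCycles (Δ.stanleyReisnerIdeal F) i (i + 1) →ₗ[F] ι → F :=
    LinearMap.pi fun p => (strandCoeff F Δ p.1.1 p.1.2 - strandCoeff F Δ p.1.1 (b p.1.1)) ∘ₗ
      Submodule.subtype _
  have hΦ : ∀ f p, Φ f p =
      strandCoeff F Δ p.1.1 p.1.2 f.1 - strandCoeff F Δ p.1.1 (b p.1.1) f.1 := fun f p => rfl
  have hker : LinearMap.ker Φ = (koszulBoundaries (Δ.stanleyReisnerIdeal F) i (i + 1)).submoduleOf
      (koszulCycles (Δ.stanleyReisnerIdeal F) i (i + 1)) := by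
    ext f
    rw [Submodule.submoduleOf, Submodule.mem_comap, LinearMap.mem_ker, Submodule.subtype_apply]
    constructor
    · intro hf
      refine exists_koszulD_eq_of_strandCoeff_eq hv f.2 (fun T => strandCoeff F Δ T (b T) f.1)
        fun T hT v hvT => ?_
      have hd : koszulD F n _ f.1 = 0 := f.2.2
      by_cases hTW : T ⊆ W
      · by_cases hvb : v = b T
        · rw [hvb]
        · have := congrFun hf ⟨⟨T, v⟩, by simp [ι, hTW, hT, hvb, hvT]⟩
          rw [hΦ] at this
          exact sub_eq_zero.mp this
      -- Here `w` forms an edge with every vertex of `T`, so all coefficients agree with the one at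
      -- `w`.
      · obtain ⟨w, hwT, hwW⟩ := Finset.not_subset.mp hTW
        exact (strandCoeff_eq_of_mem_faces hd hwT hvT (hface w v hwW)).symm.trans
          (strandCoeff_eq_of_mem_faces hd hwT (hbT T hT) (hface w _ hwW))
    · intro hf
      funext p
      obtain ⟨-, h2, -, h4⟩ := hι p
      rw [hΦ, strandCoeff_of_mem_koszulBoundaries hv hf h4 (hbT _ h2), sub_self]
      rfl
  have hsurj : Function.Surjective Φ := by
    classical
    intro φ
    -- Extending by zero gives the value 0 at each base vertex, so the differences recover `φ`.
    obtain ⟨f, hf, hfφ⟩ := exists_mem_koszulCycles_strandCoeff_eq hv hne (i := i)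
      (fun T v => if h : (⟨T, v⟩ : Σ _ : Finset (Fin n), Fin n) ∈ ι then φ ⟨_, h⟩ else 0)
      (fun T v h => by
        by_cases hm : (⟨T, v⟩ : Σ _ : Finset (Fin n), Fin n) ∈ ι
        · exact ⟨(hι ⟨_, hm⟩).1, (hι ⟨_, hm⟩).2.1⟩
        · simp [hm] at h)
    refine ⟨⟨f, hf⟩, funext fun p => ?_⟩
    obtain ⟨-, h2, -, h4⟩ := hι p
    rw [hΦ, hfφ _ _ h4, hfφ _ _ (hbT _ h2), dif_pos p.2, dif_neg (by simp [ι]), sub_zero]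
  rw [gradedBetti, ← hker, (Φ.quotKerEquivOfSurjective hsurj).finrank_eq,
    Module.finrank_fintype_fun_eq_card, Fintype.card_coe, Finset.card_sigma,
    Finset.sum_congr rfl (g := fun _ => i), Finset.sum_const, Finset.card_powersetCard, smul_eq_mul,
    mul_comm]
  intro T hT
  have hT' := (Finset.mem_powersetCard.mp hT).2
  rw [Finset.card_erase_of_mem (hbT T hT'), hT', Nat.add_sub_cancel]

end Koszul

/-! ### Faces and dimension of the join -/

theorem mem_faces_join_simplex_isolatedVertices {V : Type*} [Fintype V] [DecidableEq V]
    (W H : Finset V) :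
    H ∈ ((simplex Wᶜ).join (isolatedVertices W)).faces ↔
      ∀ a ∈ H, ∀ b ∈ H, a ∈ W → b ∈ W → a = b := by
  constructor
  · rintro ⟨F, hF, G, ⟨-, hG⟩, rfl⟩ a ha b hb haW hbW
    have key : ∀ c ∈ F ∪ G, c ∈ W → c ∈ G := fun c hc hcW =>
      (Finset.mem_union.mp hc).resolve_left fun h => Finset.mem_compl.mp (hF h) hcW
    exact Finset.card_le_one.mp hG a (key a ha haW) b (key b hb hbW)
  · intro h
    refine ⟨H \ W, fun v hv => by simp_all, H ∩ W, ⟨Finset.inter_subset_right, ?_⟩,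
      (Finset.sdiff_union_inter H W).symm⟩
    rw [Finset.card_le_one]
    intro a ha b hb
    simp only [Finset.mem_inter] at ha hb
    exact h a ha.1 b hb.1 ha.2 hb.2

theorem hasDimension_of_forall_mem_faces_iff {V : Type*} [Fintype V] [DecidableEq V]
    {Δ : FaceComplex V} {W : Finset V}
    (hΔ : ∀ H, H ∈ Δ.faces ↔ ∀ a ∈ H, ∀ b ∈ H, a ∈ W → b ∈ W → a = b) (hW : W.Nonempty) :
    Δ.HasDimension Wᶜ.card := by
  obtain ⟨w, hw⟩ := hW
  constructor
  · refine ⟨insert w Wᶜ, ?_, ?_⟩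
    · rw [hΔ]
      intro a ha b hb haW hbW
      simp_all
    · simp [Finset.card_insert_of_notMem, hw]
  · rintro _ ⟨H, hH, rfl⟩
    rw [hΔ] at hH
    have h1 : (H ∩ W).card ≤ 1 := by
      rw [Finset.card_le_one]
      intro a ha b hb
      simp only [Finset.mem_inter] at ha hb
      exact hH a ha.1 b hb.1 ha.2 hb.2
    have h2 : (H \ W).card ≤ Wᶜ.card := Finset.card_le_card fun v hv => by simp_all
    have h3 := Finset.card_sdiff_add_card_inter H W
    simp only
    omega

end FaceComplex

theorem mainTheorem11 {𝔽 : Type*} [Field 𝔽] (n d : ℕ) (hd : 0 < d) (hdn : d ≤ n)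
    (Δ : FaceComplex (Fin n))
    (hΔ : Δ = FaceComplex.join
      (FaceComplex.simplex (Finset.univ.filter fun v : Fin n => n - d + 1 ≤ (v : ℕ)))
      (FaceComplex.isolatedVertices (Finset.univ.filter fun v : Fin n => (v : ℕ) < n - d + 1))) :
    Δ.HasDimension ((d : ℤ) - 1) ∧
    Δ.IsBalanced ∧
    Δ.IsCohenMacaulay 𝔽 ∧
    ∀ i : ℕ, gradedBetti (Δ.stanleyReisnerIdeal 𝔽) i (i + 1) = i * Nat.choose (n - d + 1) (i + 1) := by
  set W : Finset (Fin n) := Finset.univ.filter fun v : Fin n => (v : ℕ) < n - d + 1 with hWdef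
  have hWc : (Finset.univ.filter fun v : Fin n => n - d + 1 ≤ (v : ℕ)) = Wᶜ := by
    ext v; simp [hWdef]
  have hcard : W.card = n - d + 1 := by
    rw [hWdef, Fin.card_filter_val_lt]
    omega
  have hcardc : Wᶜ.card = d - 1 := by
    rw [Finset.card_compl, hcard, Fintype.card_fin]
    omega
  have hWne : W.Nonempty := Finset.card_pos.mp (by omega)
  have hfaces : ∀ H, H ∈ Δ.faces ↔ ∀ a ∈ H, ∀ b ∈ H, a ∈ W → b ∈ W → a = b := by
    intro H
    rw [hΔ, hWc]
    exact FaceComplex.mem_faces_join_simplex_isolatedVertices W H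
  have hdim : Δ.HasDimension ((d : ℤ) - 1) := by
    have := FaceComplex.hasDimension_of_forall_mem_faces_iff hfaces hWne
    rwa [hcardc, Nat.cast_sub hd, Nat.cast_one] at this
  -- With vertices numbered from 0, truncated subtraction gives every vertex of `W` (those with v ≤
  -- n-d) the colour 0, and gives the other d-1 vertices the distinct colours 1, …, d-1.
  refine ⟨hdim, ⟨d, hdim, fun k => {v | (v : ℕ) - (n - d) = k}, ?_, ?_, ?_⟩,
    FaceComplex.isCohenMacaulay_of_forall_mem_faces_iff hfaces hWne, fun i => ?_⟩
  · intro k l hkl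
    rw [Set.disjoint_left]
    intro v hv hv'
    simp only [Set.mem_ofPred_eq] at hv hv'
    exact hkl (Fin.ext (hv.symm.trans hv'))
  · ext v
    simp only [Set.mem_iUnion, Set.mem_ofPred_eq, FaceComplex.vertices, hfaces]
    refine iff_of_true ⟨⟨(v : ℕ) - (n - d), by omega⟩, rfl⟩ fun a ha b hb _ _ => ?_
    rw [Finset.mem_singleton.mp ha, Finset.mem_singleton.mp hb]
  · intro H hH k
    rw [hfaces] at hH
    rw [Set.ncard_le_one]
    rintro a ⟨ha, hak⟩ b ⟨hb, hbk⟩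
    simp only [Set.mem_ofPred_eq] at hak hbk
    -- In colour 0 both vertices lie in `W` and the face condition applies; in a positive colour
    -- nothing is truncated, so equal colours force equal vertices.
    by_cases haW : (a : ℕ) < n - d + 1
    · exact hH a ha b hb (by simp only [hWdef, Finset.mem_filter_univ, haW])
        (by simp only [hWdef, Finset.mem_filter_univ]; omega)
    · exact Fin.ext (by omega)
  · rw [FaceComplex.gradedBetti_succ_of_forall_mem_faces_iff hfaces hWne, hcard]
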